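/- **Model.** An instance on $p>0$ processors is a collection of $m$ sets of jobs $S_1,\dots,S_m$, where $S_i$ consists of $n_i$ jobs $J_{ij}$, all released at time $0$; write $n=\max_i n_i$. A job is a finite sequence of phases; a phase consists of an amount of work $w\ge 0$ and a speed-up function $\Gamma:[0,\infty)\to[0,\infty)$ that is non-decreasing and sub-linear ($\Gamma(\rho')/\rho'\le\Gamma(\rho)/\rho$ for $0<\rho<\rho'$). A schedule on $p$ processors is a family of piecewise constant functions $\rho_{ij}:[0,\infty)\to[0,\infty)$ with $\sum_{i,j}\rho_{ij}(t)\le p$ at all times $t$. The phases of a job are executed one after the other from time $0$: a phase $(w,\Gamma)$ of $J_{ij}$ that starts at time $a$ ends at the first time $b\ge a$ with $\int_a^b\Gamma(\rho_{ij}(t))\,dt=w$ (at $\infty$ if there is none), and the completion time $c_{ij}$ of $J_{ij}$ is the end of its last phase. A schedule is valid if all $c_{ij}$ are finite; its setflowtime is $\sum_{i=1}^m\max_j c_{ij}$; $\mathrm{OPT}_p(S)$ is the infimum of the setflowtime over all valid schedules of $S$ on $p$ processors ($\infty$ if there are none). A (deterministic) non-clairvoyant algorithm on $p$ processors assigns to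 every instance a schedule on $p$ processors whose allocation at time $t$ depends only on $n_1,\dots,n_m$ and on which jobs have completed at which times up to $t$. A randomized one is a random deterministic one (over a probability space on which the setflowtime of every instance is measurable); its cost is its expected setflowtime. An algorithm on $sp$ processors is $s$-speed $c$-competitive on a class of instances if its (expected) setflowtime is at most $c\cdot\mathrm{OPT}_p(S)$ for all instances $S$ of the class; $c$-competitive means $1$-speed $c$-competitive. The strategy EQ∘EQ on $p$ processors allots at every time $t$ to each uncompleted job of $S_i$ the amount $\frac{p}{N(t)\,N_i(t)}$ and nothing to completed jobs, where $N(t)$ is the number of sets that have an uncompleted job at time $t$ and $N_i(t)$ is the number of uncompleted jobs of $S_i$ at time $t$. **Theorem.** 1. For every $p>0$, EQ∘EQ on $p$ processors is a well-defined non-clairvoyant algorithm: for every instance there is exactly one schedule that follows its rule, and the resulting algorithm is non-clairvoyant. 2. There is a function $\varepsilon:\mathbb N\to\mathbb R$ with $\varepsilon(n)\to0$ such that for all $n\ge3$ and all $p>0$, EQ∘EQ on $p$ processors is $\frac{(2+\sqrt3+\varepsilon(n))\ln n}{\ln\ln n}$-competitive for setflowtime minimization on the collections of sets (of any number) whose largest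 set has $n$ jobs. 3. Let $s:\mathbb N\to(0,\infty)$ with $s(n)=o\!\left(\frac{\ln n}{\ln\ln n}\right)$. For all sufficiently large $n$ (depending only on $s$), all $p>0$ and all real $c$: no deterministic non-clairvoyant algorithm is $s(n)$-speed $c$-competitive on collections whose largest set has $n$ jobs if $c<\frac{\ln n}{2\ln\ln n}$, and no randomized one is if $c<\frac{\ln n}{4\ln\ln n}$. In both cases the bound is already violated by an instance that consists of a single set of $n$ jobs. -/

import Mathlib

open scoped ENNReal

namespace SetScheduling

/-- A phase of a job: an amount of work together with a speed-up function
`Γ : [0, ∞) → [0, ∞)` that is non-decreasing and sub-linear.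
The values of `speedup` at negative arguments are irrelevant. -/
structure Phase where
  work : ℝ
  work_nonneg : 0 ≤ work
  speedup : ℝ → ℝ
  speedup_nonneg : ∀ ρ, 0 ≤ ρ → 0 ≤ speedup ρ
  nondecreasing : ∀ ρ ρ', 0 ≤ ρ → ρ ≤ ρ' → speedup ρ ≤ speedup ρ'
  sublinear : ∀ ρ ρ', 0 < ρ → ρ < ρ' → speedup ρ' / ρ' ≤ speedup ρ / ρ

/-- The jobs of a collection of `m` sets, the `i`-th of which has `size i` jobs. -/
abbrev Job {m : ℕ} (size : Fin m → ℕ) : Type := Σ i : Fin m, Fin (size i)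

/-- An instance: every job, released at time `0`, is a finite sequence of phases. -/
abbrev Instance {m : ℕ} (size : Fin m → ℕ) : Type := Job size → List Phase

/-- `f` is piecewise constant on `[0, ∞)`: there is a set of breakpoints, finitely many in every
bounded interval, such that `f` is constant on every open interval without breakpoints. -/
def IsPiecewiseConstant (f : ℝ → ℝ) : Prop :=
  ∃ B : Set ℝ, (∀ T : ℝ, (B ∩ Set.Icc 0 T).Finite) ∧
    ∀ a b : ℝ, 0 ≤ a → a < b → Disjoint (Set.Ioo a b) B →
      ∃ c : ℝ, ∀ t ∈ Set.Ioo a b, f t = c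

/-- A schedule on `p` processors: `alloc J t` is the amount of processors allotted to the
job `J` at time `t ≥ 0`. -/
structure Schedule {m : ℕ} (size : Fin m → ℕ) (p : ℝ) where
  alloc : Job size → ℝ → ℝ
  nonneg : ∀ J t, 0 ≤ t → 0 ≤ alloc J t
  capacity : ∀ t, 0 ≤ t → ∑ J, alloc J t ≤ p
  piecewiseConstant : ∀ J, IsPiecewiseConstant (alloc J)

/-- Completion time of the phase `P` that starts at time `a`, for a job that is allotted `ρ t`
processors at time `t`: the first time `b ≥ a` at which the work accomplished since `a` equals
the work of the phase; it is `∞` if there is no such time, or if `a = ∞`. -/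
noncomputable def phaseCompletion (ρ : ℝ → ℝ) (a : ℝ≥0∞) (P : Phase) : ℝ≥0∞ :=
  sInf {b : ℝ≥0∞ | a ≤ b ∧ b ≠ ∞ ∧ ∫ t in a.toReal..b.toReal, P.speedup (ρ t) = P.work}

/-- Completion time of a job: its phases are executed one after the other from time `0`. -/
noncomputable def jobCompletion (phases : List Phase) (ρ : ℝ → ℝ) : ℝ≥0∞ :=
  phases.foldl (phaseCompletion ρ) 0

section

variable {m : ℕ} {size : Fin m → ℕ} {p : ℝ}

/-- The completion time of the job `J` in the schedule `σ` of the instance `S`. -/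
noncomputable def completionTime (S : Instance size) (σ : Schedule size p) (J : Job size) :
    ℝ≥0∞ :=
  jobCompletion (S J) (σ.alloc J)

/-- A schedule is valid if all jobs eventually complete. -/
def IsValid (S : Instance size) (σ : Schedule size p) : Prop :=
  ∀ J, completionTime S σ J < ∞

/-- The completion time of the `i`-th set: the maximum of the completion times of its jobs. -/
noncomputable def setCompletionTime (S : Instance size) (σ : Schedule size p) (i : Fin m) :
    ℝ≥0∞ :=
  ⨆ j : Fin (size i), completionTime S σ ⟨i, j⟩

/-- The setflowtime of a schedule: the sum of the completion times of the sets. -/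
noncomputable def setflowtime (S : Instance size) (σ : Schedule size p) : ℝ≥0∞ :=
  ∑ i, setCompletionTime S σ i

/-- The optimal setflowtime on `p` processors (`∞` if there is no valid schedule). -/
noncomputable def OPT (p : ℝ) (S : Instance size) : ℝ≥0∞ :=
  ⨅ (σ : Schedule size p) (_ : IsValid S σ), setflowtime S σ

/-- The job `J` is completed at time `t`. -/
def Completed (S : Instance size) (σ : Schedule size p) (J : Job size) (t : ℝ) : Prop :=
  completionTime S σ J ≤ ENNReal.ofReal t

/-- `N(t)`: the number of sets with an uncompleted job at time `t`. -/
noncomputable def numSets (S : Instance size) (σ : Schedule size p) (t : ℝ) : ℕ :=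
  Nat.card {i : Fin m // ∃ j, ¬ Completed S σ ⟨i, j⟩ t}

/-- `N_i(t)`: the number of uncompleted jobs of the `i`-th set at time `t`. -/
noncomputable def numJobs (S : Instance size) (σ : Schedule size p) (i : Fin m) (t : ℝ) : ℕ :=
  Nat.card {j : Fin (size i) // ¬ Completed S σ ⟨i, j⟩ t}

/-- `σ` is the schedule computed by EQ∘EQ on `p` processors: at any time `t` every uncompleted
job of the `i`-th set is allotted `p / (N(t) * N_i(t))` processors, and completed jobs none. -/
def IsEqEq (S : Instance size) (σ : Schedule size p) : Prop :=
  ∀ (i : Fin m) (j : Fin (size i)) (t : ℝ), 0 ≤ t →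
    (¬ Completed S σ ⟨i, j⟩ t →
      σ.alloc ⟨i, j⟩ t = p / ((numSets S σ t : ℝ) * (numJobs S σ i t : ℝ))) ∧
    (Completed S σ ⟨i, j⟩ t → σ.alloc ⟨i, j⟩ t = 0)

end

/-- A deterministic non-clairvoyant algorithm on `p` processors. It computes a schedule of every
instance, and its allocation at time `t` depends only on the numbers of jobs of the sets and on
which jobs have completed at which times up to `t`. -/
structure NonClairvoyantAlgorithm (p : ℝ) where
  schedule : ∀ {m : ℕ} {size : Fin m → ℕ}, Instance size → Schedule size p
  nonclairvoyant : ∀ {m : ℕ} {size : Fin m → ℕ} (S S' : Instance size) (t : ℝ), 0 ≤ t →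
    (∀ u, 0 ≤ u → u ≤ t → ∀ J,
      (Completed S (schedule S) J u ↔ Completed S' (schedule S') J u)) →
    ∀ J, (schedule S).alloc J t = (schedule S').alloc J t

end SetScheduling

namespace SetScheduling

open MeasureTheory

/-! Well-definedness of EQ∘EQ. Whether a job has completed by time `t` depends only on its
allocation before `t`, and no job completes immediately after a given time. Hence two causal
schedules cannot have a first time of disagreement (`alloc_agree`), which gives uniqueness.
Existence follows by recursion over the completions: rates stay constant until the next one
(`exists_partial_eqEq`).

Upper bound. Compare EQ∘EQ with an arbitrary valid schedule `τ`. For each phase a threshold on the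
EQ∘EQ allocation is chosen (`threshold_split`). Times above it count as sequential, and their length
is at most 10/9 of the duration of the phase in `τ`; times below it count as parallel, and the
allocation spent on them is at most 10 times that of `τ`. While fewer than a fraction `1/(2β)` of
the live jobs of a set are parallel, the number of live jobs drops by a factor `β` in time
proportional to the completion time of the set in `τ`, so such times add up to about `ln n / ln β`
times that completion time (`integral_sequential_le`). At other times the share `p/N` of the set is
used for parallel work up to a factor `2β`. Ordering the sets by their completion in `τ` bounds the
resulting flow time as for EQUI on parallel jobs (`IsEqEq.integral_numSets_le`). Taking `β` close to
`(ln n)^(9/10)` makes the first contribution dominate; its constant is below 3, hence below `2 +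
√3`.

Lower bound. Every job is some parallel work followed by one unit of sequential work, so the end of
the parallel work is revealed one time unit late. The optimum needs about one time unit if the total
parallel work is small. A deterministic adversary plays `L` unit rounds with `k ^ L`
indistinguishable jobs; in each round it keeps a fraction `1/k` that received little, and declares
the others to have small work (`deterministic_adversary`). Against randomization, works of
geometrically growing size are drawn at random, a random job receives the largest one, and the costs
are averaged over the instances (`card_spoiled_le`, `randomized_adversary`). With `k` a power of `ln
n`, `L` is of the order `ln n / ln ln n`. -/

/-- Piecewise constant functions on `[0, ∞)` with values in an arbitrary type. -/
def PC {α : Type*} (f : ℝ → α) : Prop :=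
  ∃ B : Set ℝ, (∀ T : ℝ, (B ∩ Set.Icc 0 T).Finite) ∧
    ∀ a b : ℝ, 0 ≤ a → a < b → Disjoint (Set.Ioo a b) B →
      ∃ c : α, ∀ t ∈ Set.Ioo a b, f t = c

/-! ### Calculus of piecewise constant functions -/

namespace PC

variable {α β ι : Type*}

theorem comp {f : ℝ → α} (hf : PC f) (g : α → β) : PC fun t => g (f t) := by
  obtain ⟨B, hB, h⟩ := hf
  refine ⟨B, hB, fun a b ha hab hd => ?_⟩
  obtain ⟨c, hc⟩ := h a b ha hab hd
  exact ⟨g c, fun t ht => congrArg g (hc t ht)⟩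

theorem congr {f g : ℝ → α} (hf : PC f) (h : ∀ t, 0 ≤ t → f t = g t) : PC g := by
  obtain ⟨B, hB, hc⟩ := hf
  refine ⟨B, hB, fun a b ha hab hd => ?_⟩
  obtain ⟨c, hc⟩ := hc a b ha hab hd
  exact ⟨c, fun t ht => by rw [← h t (ha.trans ht.1.le), hc t ht]⟩

theorem const (c : α) : PC fun _ : ℝ => c :=
  ⟨∅, by simp, fun _ _ _ _ _ => ⟨c, fun _ _ => rfl⟩⟩

theorem pi [Finite ι] {f : ι → ℝ → α} (hf : ∀ i, PC (f i)) : PC fun t i => f i t := by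
  choose B hB h using hf
  refine ⟨⋃ i, B i, fun T => ?_, fun a b ha hab hd => ?_⟩
  · rw [Set.iUnion_inter]
    exact Set.finite_iUnion fun i => hB i T
  · rw [Set.disjoint_iUnion_right] at hd
    choose c hc using fun i => h i a b ha hab (hd i)
    exact ⟨c, fun t ht => funext fun i => hc i t ht⟩

theorem prodMk {f : ℝ → α} {g : ℝ → β} (hf : PC f) (hg : PC g) : PC fun t => (f t, g t) := by
  obtain ⟨B, hB, h⟩ := hf
  obtain ⟨B', hB', h'⟩ := hg
  refine ⟨B ∪ B', fun T => ?_, fun a b ha hab hd => ?_⟩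
  · rw [Set.union_inter_distrib_right]
    exact (hB T).union (hB' T)
  · rw [Set.disjoint_union_right] at hd
    obtain ⟨c, hc⟩ := h a b ha hab hd.1
    obtain ⟨c', hc'⟩ := h' a b ha hab hd.2
    exact ⟨(c, c'), fun t ht => Prod.ext (hc t ht) (hc' t ht)⟩

theorem comp₂ {γ : Type*} {f : ℝ → α} {g : ℝ → β} (hf : PC f) (hg : PC g) (k : α → β → γ) :
    PC fun t => k (f t) (g t) :=
  (hf.prodMk hg).comp fun x => k x.1 x.2

theorem le_ofReal (c : ℝ≥0∞) : PC fun t => c ≤ ENNReal.ofReal t := by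
  refine ⟨{c.toReal}, fun T => (Set.finite_singleton _).inter_of_left _,
    fun a b ha hab hd => ?_⟩
  rw [Set.disjoint_singleton_right] at hd
  rcases eq_or_ne c ∞ with rfl | hc
  · exact ⟨False, fun t _ => by simp⟩
  · have key : ∀ t ∈ Set.Ioo a b, (c ≤ ENNReal.ofReal t ↔ c.toReal ≤ t) := fun t ht =>
      ENNReal.le_ofReal_iff_toReal_le hc (ha.trans ht.1.le)
    by_cases h : c.toReal ≤ a
    · exact ⟨True, fun t ht => by simpa using (key t ht).2 (h.trans ht.1.le)⟩
    · refine ⟨False, fun t ht => ?_⟩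
      have : b ≤ c.toReal := by
        by_contra h'
        exact hd ⟨not_le.1 h, not_le.1 h'⟩
      simpa [key t ht] using ht.2.trans_le this

theorem intervalIntegrable {f : ℝ → ℝ} (hf : PC f) {a b : ℝ} (ha : 0 ≤ a) (hb : 0 ≤ b) :
    IntervalIntegrable f volume a b := by
  obtain ⟨B, hB, h⟩ := hf
  -- Induction on the number of breakpoints inside the interval, cutting at one of them.
  have key : ∀ (n : ℕ) (a b : ℝ), 0 ≤ a → a ≤ b → (B ∩ Set.Ioo a b).ncard ≤ n →
      IntervalIntegrable f volume a b := by
    intro n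
    induction n using Nat.strong_induction_on with
    | _ n ih =>
      intro a b ha hab hn
      rcases hab.eq_or_lt with rfl | hab
      · exact IntervalIntegrable.refl
      have hfin : (B ∩ Set.Ioo a b).Finite :=
        (hB b).subset fun x hx => ⟨hx.1, ha.trans hx.2.1.le, hx.2.2.le⟩
      by_cases he : (B ∩ Set.Ioo a b) = ∅
      · obtain ⟨c, hc⟩ := h a b ha hab (by
          rw [Set.disjoint_iff_inter_eq_empty, Set.inter_comm, he])
        have : IntervalIntegrable (fun _ : ℝ => c) volume a b := intervalIntegrable_const
        refine this.congr_uIoo fun t ht => ?_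
        rw [Set.uIoo_of_le hab.le] at ht
        exact (hc t ht).symm
      · obtain ⟨x, hxB, hx⟩ := Set.nonempty_iff_ne_empty.2 he
        have lt : ∀ a' b', a ≤ a' → b' ≤ b → x ∉ Set.Ioo a' b' →
            (B ∩ Set.Ioo a' b').ncard < n := fun a' b' h1 h2 h3 => by
          refine lt_of_lt_of_le (Set.ncard_lt_ncard ?_ hfin) hn
          refine ⟨fun y hy => ⟨hy.1, h1.trans_lt hy.2.1, hy.2.2.trans_le h2⟩, fun hs => ?_⟩
          exact h3 (hs ⟨hxB, hx⟩).2
        exact (ih _ (lt a x le_rfl hx.2.le (by simp)) a x ha hx.1.le le_rfl).trans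
          (ih _ (lt x b hx.1.le le_rfl (by simp)) x b (ha.trans hx.1.le) hx.2.le le_rfl)
  rcases le_total a b with hab | hab
  · exact key _ a b ha hab le_rfl
  · exact (key _ b a hb hab le_rfl).symm

theorem continuousOn_primitive {f : ℝ → ℝ} (hf : PC f) {a M : ℝ} (ha : 0 ≤ a) (haM : a ≤ M) :
    ContinuousOn (fun b => ∫ s in a..b, f s) (Set.Icc 0 M) := by
  have := intervalIntegral.continuousOn_primitive_interval' (a := a)
    (hf.intervalIntegrable le_rfl (ha.trans haM)) (by
      rw [Set.uIcc_of_le (ha.trans haM)]; exact ⟨ha, haM⟩)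
  rwa [Set.uIcc_of_le (ha.trans haM)] at this

theorem integral_add {f : ℝ → ℝ} (hf : PC f) {a b c : ℝ} (ha : 0 ≤ a) (hb : 0 ≤ b)
    (hc : 0 ≤ c) : (∫ s in a..b, f s) + ∫ s in b..c, f s = ∫ s in a..c, f s :=
  intervalIntegral.integral_add_adjacent_intervals (hf.intervalIntegrable ha hb)
    (hf.intervalIntegrable hb hc)

theorem integral_nonneg {f : ℝ → ℝ} (h0 : ∀ t, 0 ≤ t → 0 ≤ f t) {a b : ℝ} (ha : 0 ≤ a)
    (hab : a ≤ b) : 0 ≤ ∫ s in a..b, f s :=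
  intervalIntegral.integral_nonneg hab fun t ht => h0 t (ha.trans ht.1)

theorem integral_mono_right {f : ℝ → ℝ} (hf : PC f) (h0 : ∀ t, 0 ≤ t → 0 ≤ f t) {a b c : ℝ}
    (ha : 0 ≤ a) (hb : 0 ≤ b) (hbc : b ≤ c) : ∫ s in a..b, f s ≤ ∫ s in a..c, f s := by
  rw [← hf.integral_add ha hb (hb.trans hbc)]
  linarith [integral_nonneg h0 hb hbc]

theorem integral_mono {f g : ℝ → ℝ} (hf : PC f) (hg : PC g) {a b : ℝ} (ha : 0 ≤ a)
    (hab : a ≤ b) (h : ∀ t, a ≤ t → t ≤ b → f t ≤ g t) :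
    ∫ s in a..b, f s ≤ ∫ s in a..b, g s :=
  intervalIntegral.integral_mono_on hab (hf.intervalIntegrable ha (ha.trans hab))
    (hg.intervalIntegrable ha (ha.trans hab)) fun t ht => h t ht.1 ht.2

theorem sum {s : Finset ι} {f : ι → ℝ → ℝ} (hf : ∀ i, PC (f i)) :
    PC fun t => ∑ i ∈ s, f i t := by
  classical
  induction s using Finset.induction_on with
  | empty => simpa using PC.const (0 : ℝ)
  | insert i s hi ih =>
    simp only [Finset.sum_insert hi]
    exact (hf i).comp₂ ih (· + ·)

theorem integral_sum {s : Finset ι} {f : ι → ℝ → ℝ} (hf : ∀ i, PC (f i)) {a b : ℝ}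
    (ha : 0 ≤ a) (hb : 0 ≤ b) :
    ∫ t in a..b, ∑ i ∈ s, f i t = ∑ i ∈ s, ∫ t in a..b, f i t :=
  intervalIntegral.integral_finsetSum fun i _ => (hf i).intervalIntegrable ha hb

end PC

/-! ### Completion times and their dependence on the past -/

section Completion

variable {ρ ρ' : ℝ → ℝ} {a a' : ℝ≥0∞} {P : Phase} {t : ℝ}

theorem le_phaseCompletion : a ≤ phaseCompletion ρ a P :=
  le_sInf fun _ hb => hb.1

theorem Phase.speedup_comp_nonneg (P : Phase) (h0 : ∀ t, 0 ≤ t → 0 ≤ ρ t) :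
    ∀ t, 0 ≤ t → 0 ≤ P.speedup (ρ t) :=
  fun t ht => P.speedup_nonneg _ (h0 t ht)

/-- Replaces the infimum of exact hitting times by a monotone condition on accumulated work. This is
possible because the accumulated work is continuous and non-decreasing. -/
theorem phaseCompletion_le_iff (hρ : PC ρ) (h0 : ∀ t, 0 ≤ t → 0 ≤ ρ t) (ht : 0 ≤ t) :
    phaseCompletion ρ a P ≤ ENNReal.ofReal t ↔
      a ≤ ENNReal.ofReal t ∧ P.work ≤ ∫ s in a.toReal..t, P.speedup (ρ s) := by
  have hg := hρ.comp P.speedup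
  have hg0 := P.speedup_comp_nonneg h0
  have ha0 : 0 ≤ a.toReal := ENNReal.toReal_nonneg
  constructor
  · intro h
    have ha : a ≤ ENNReal.ofReal t := le_phaseCompletion.trans h
    have hat : a.toReal ≤ t := ENNReal.toReal_le_of_le_ofReal ht ha
    refine ⟨ha, ?_⟩
    -- If work is missing at `t`, it is still missing slightly later by continuity, so the infimum
    -- cannot be at most `t`.
    by_contra! hlt
    have hc := (hg.continuousOn_primitive ha0 (hat.trans (lt_add_one t).le)) t
      ⟨ht, (lt_add_one t).le⟩
    have hev := hc.eventually (gt_mem_nhds hlt)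
    obtain ⟨δ, hδ, hball⟩ := Metric.mem_nhdsWithin_iff.1 hev
    have h1 : phaseCompletion ρ a P < ENNReal.ofReal (t + min δ 1) :=
      h.trans_lt ((ENNReal.ofReal_lt_ofReal_iff (by positivity)).2 (by
        have : 0 < min δ 1 := by positivity
        linarith))
    obtain ⟨b, ⟨hab, hbt, hbw⟩, hb⟩ := sInf_lt_iff.1 h1
    have hb' : b.toReal < t + min δ 1 := by
      rw [← ENNReal.ofReal_toReal hbt] at hb
      exact (ENNReal.ofReal_lt_ofReal_iff (by positivity)).1 hb
    rcases le_total b.toReal t with hbt' | hbt'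
    · have := hg.integral_mono_right hg0 ha0 ENNReal.toReal_nonneg hbt'
      linarith
    · have : b.toReal ∈ Metric.ball t δ ∩ Set.Icc 0 (t + 1) := by
        refine ⟨?_, ENNReal.toReal_nonneg, ?_⟩
        · rw [Metric.mem_ball, Real.dist_eq, abs_of_nonneg (by linarith)]
          linarith [min_le_left δ 1]
        · linarith [min_le_right δ 1]
      have := hball this
      simp only [Set.mem_ofPred_eq] at this
      linarith
  · rintro ⟨ha, hw⟩
    have hat : a.toReal ≤ t := ENNReal.toReal_le_of_le_ofReal ht ha
    have hc : ContinuousOn (fun b => ∫ s in a.toReal..b, P.speedup (ρ s))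
        (Set.Icc a.toReal t) :=
      (hg.continuousOn_primitive ha0 hat).mono (Set.Icc_subset_Icc_left ha0)
    have hmem : P.work ∈ Set.Icc (∫ s in a.toReal..a.toReal, P.speedup (ρ s))
        (∫ s in a.toReal..t, P.speedup (ρ s)) := ⟨by simpa using P.work_nonneg, hw⟩
    obtain ⟨b, hb, hbw⟩ := intermediate_value_Icc hat hc hmem
    have hb0 : 0 ≤ b := ha0.trans hb.1
    refine le_trans (b := ENNReal.ofReal b) (sInf_le ?_) (ENNReal.ofReal_le_ofReal hb.2)
    refine ⟨?_, ENNReal.ofReal_ne_top, ?_⟩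
    · exact (ENNReal.le_ofReal_iff_toReal_le (ne_top_of_le_ne_top ENNReal.ofReal_ne_top ha)
        hb0).2 hb.1
    · rw [ENNReal.toReal_ofReal hb0, ← hbw]

theorem phaseCompletion_congr (hρ : PC ρ) (h0 : ∀ t, 0 ≤ t → 0 ≤ ρ t) (hρ' : PC ρ')
    (h0' : ∀ t, 0 ≤ t → 0 ≤ ρ' t) (h : ∀ s, 0 ≤ s → s < t → ρ s = ρ' s)
    (ha : ∀ u, 0 ≤ u → u ≤ t → (a ≤ ENNReal.ofReal u ↔ a' ≤ ENNReal.ofReal u)) :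
    ∀ u, 0 ≤ u → u ≤ t → (phaseCompletion ρ a P ≤ ENNReal.ofReal u ↔
      phaseCompletion ρ' a' P ≤ ENNReal.ofReal u) := by
  intro u hu hut
  rw [phaseCompletion_le_iff hρ h0 hu, phaseCompletion_le_iff hρ' h0' hu, ← ha u hu hut]
  refine and_congr_right fun hau => ?_
  have hau' := (ha u hu hut).1 hau
  have hne := ne_top_of_le_ne_top ENNReal.ofReal_ne_top hau
  have hne' := ne_top_of_le_ne_top ENNReal.ofReal_ne_top hau'
  have hr := ENNReal.toReal_le_of_le_ofReal hu hau
  have hr' := ENNReal.toReal_le_of_le_ofReal hu hau'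
  -- Both starting times are at most `u`, and no time up to `t` separates them.
  have e : a = a' := by
    apply le_antisymm
    · have := (ha a'.toReal ENNReal.toReal_nonneg (hr'.trans hut)).2
        (by rw [ENNReal.ofReal_toReal hne'])
      rwa [ENNReal.ofReal_toReal hne'] at this
    · have := (ha a.toReal ENNReal.toReal_nonneg (hr.trans hut)).1
        (by rw [ENNReal.ofReal_toReal hne])
      rwa [ENNReal.ofReal_toReal hne] at this
  subst e
  rw [intervalIntegral.integral_congr_uIoo]
  intro s hs
  rw [Set.uIoo_of_le hr] at hs
  simp only [h s (ENNReal.toReal_nonneg.trans hs.1.le) (hs.2.trans_le hut)]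

/-- Whether a job has completed by time `t` depends on its allocation before `t` only. -/
theorem jobCompletion_congr (l : List Phase) (hρ : PC ρ) (h0 : ∀ t, 0 ≤ t → 0 ≤ ρ t)
    (hρ' : PC ρ') (h0' : ∀ t, 0 ≤ t → 0 ≤ ρ' t) (h : ∀ s, 0 ≤ s → s < t → ρ s = ρ' s)
    (ht : 0 ≤ t) :
    jobCompletion l ρ ≤ ENNReal.ofReal t ↔ jobCompletion l ρ' ≤ ENNReal.ofReal t := by
  suffices ∀ (l : List Phase) (a a' : ℝ≥0∞),
      (∀ u, 0 ≤ u → u ≤ t → (a ≤ ENNReal.ofReal u ↔ a' ≤ ENNReal.ofReal u)) →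
      (l.foldl (phaseCompletion ρ) a ≤ ENNReal.ofReal t ↔
        l.foldl (phaseCompletion ρ') a' ≤ ENNReal.ofReal t) from
    this l 0 0 fun _ _ _ => Iff.rfl
  intro l
  induction l with
  | nil => exact fun a a' ha => ha t ht le_rfl
  | cons P l ih =>
    exact fun a a' ha => ih _ _ (phaseCompletion_congr hρ h0 hρ' h0' h ha)

end Completion

/-! ### Causal schedules that see the same completions agree -/

section Agreement

variable {m : ℕ} {size : Fin m → ℕ} {p : ℝ}

theorem Schedule.pc (σ : Schedule size p) (J : Job size) : PC (σ.alloc J) :=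
  σ.piecewiseConstant J

theorem Completed.mono {S : Instance size} {σ : Schedule size p} {J : Job size} {t u : ℝ}
    (h : Completed S σ J t) (htu : t ≤ u) : Completed S σ J u :=
  le_trans (show completionTime S σ J ≤ _ from h) (ENNReal.ofReal_le_ofReal htu)

theorem completed_congr {S : Instance size} {σ σ' : Schedule size p} {J : Job size} {t : ℝ}
    (ht : 0 ≤ t) (h : ∀ s, 0 ≤ s → s < t → σ.alloc J s = σ'.alloc J s) :
    Completed S σ J t ↔ Completed S σ' J t :=
  jobCompletion_congr _ (σ.pc J) (σ.nonneg J) (σ'.pc J) (σ'.nonneg J) h ht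

/-- Just after any time `s` no job completes. -/
theorem exists_completed_iff (S : Instance size) (σ : Schedule size p) (s : ℝ) (hs : 0 ≤ s) :
    ∃ e > s, ∀ u, s ≤ u → u < e → ∀ J, (Completed S σ J u ↔ Completed S σ J s) := by
  have key : ∀ J, ∃ e > s, ∀ u, s ≤ u → u < e → (Completed S σ J u ↔ Completed S σ J s) := by
    intro J
    by_cases h : Completed S σ J s
    · exact ⟨s + 1, by simp, fun u hu _ => iff_of_true (h.mono hu) h⟩
    · have h' : ENNReal.ofReal s < completionTime S σ J := not_le.1 h
      obtain ⟨e, he1, he2⟩ := ENNReal.lt_iff_exists_real_btwn.1 h'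
      refine ⟨e, (ENNReal.ofReal_lt_ofReal_iff_of_nonneg hs).1 he2.1,
        fun u hu hue => iff_of_false (fun hc => ?_) h⟩
      exact absurd ((hc.mono hue.le)) (not_le.2 he2.2)
  choose e he h using key
  by_cases hJ : Nonempty (Job size)
  · obtain ⟨J₀, hJ₀⟩ := Finite.exists_min e
    exact ⟨e J₀, he J₀, fun u hu hue J => h J u hu (hue.trans_le (hJ₀ J))⟩
  · exact ⟨s + 1, by simp, fun u _ _ J => (hJ ⟨J⟩).elim⟩

/-- Two causal schedules agree before time `T` if the jobs of both instances complete at the same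
times before `T` under the first one. -/
theorem alloc_agree {S S' : Instance size} {σ σ' : Schedule size p} {T : ℝ}
    (hcausal : ∀ t, 0 ≤ t →
      (∀ u, 0 ≤ u → u ≤ t → ∀ J, (Completed S σ J u ↔ Completed S' σ' J u)) →
      ∀ J, σ.alloc J t = σ'.alloc J t)
    (hsame : ∀ u, 0 ≤ u → u < T → ∀ J, (Completed S σ J u ↔ Completed S' σ J u)) :
    ∀ t, 0 ≤ t → t < T → ∀ J, σ.alloc J t = σ'.alloc J t := by
  by_contra! hcon
  obtain ⟨t₀, ht₀, ht₀T, J₀, hJ₀⟩ := hcon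
  -- Up to and including `sInf D` the completions coincide, since they depend on earlier allocations
  -- only. Nothing completes just afterwards, so causality carries the agreement past `sInf D`.
  set D : Set ℝ := {t | 0 ≤ t ∧ ∃ J, σ.alloc J t ≠ σ'.alloc J t}
  have hbdd : BddBelow D := ⟨0, fun t ht => ht.1⟩
  have hmem : t₀ ∈ D := ⟨ht₀, J₀, hJ₀⟩
  have hne : D.Nonempty := ⟨t₀, hmem⟩
  have hs0 : 0 ≤ sInf D := le_csInf hne fun t ht => ht.1
  have hsT : sInf D < T := (csInf_le hbdd hmem).trans_lt ht₀T
  have hbefore : ∀ t, 0 ≤ t → t < sInf D → ∀ J, σ.alloc J t = σ'.alloc J t := by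
    intro t ht hts J
    by_contra h
    exact not_le.2 hts (csInf_le hbdd ⟨ht, J, h⟩)
  have hcomp : ∀ u, 0 ≤ u → u ≤ sInf D → ∀ J, (Completed S σ J u ↔ Completed S' σ' J u) := by
    intro u hu hus J
    rw [hsame u hu (hus.trans_lt hsT) J]
    exact completed_congr hu fun s hs hsu => hbefore s hs (hsu.trans_le hus) J
  obtain ⟨e, he, h⟩ := exists_completed_iff S σ (sInf D) hs0
  obtain ⟨e', he', h'⟩ := exists_completed_iff S' σ' (sInf D) hs0
  obtain ⟨t, htD, hte⟩ := exists_lt_of_csInf_lt hne (lt_min he he')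
  obtain ⟨J, hJ⟩ := htD.2
  refine hJ (hcausal t htD.1 (fun u hu hut J => ?_) J)
  rcases le_total u (sInf D) with hus | hus
  · exact hcomp u hu hus J
  · have hue := hut.trans_lt hte
    rw [h u hus (hue.trans_le (min_le_left _ _)) J, h' u hus (hue.trans_le (min_le_right _ _)) J]
    exact hcomp _ hs0 le_rfl J

end Agreement

/-! ### Existence, uniqueness and causality of EQ∘EQ -/

section EqEq

variable {m : ℕ} {size : Fin m → ℕ} {p : ℝ}

open Classical in
/-- The allocation of EQ∘EQ to the job `J` when the completed jobs are those in `C`. -/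
noncomputable def eqRate (p : ℝ) (C : Job size → Prop) (J : Job size) : ℝ :=
  if C J then 0 else
    p / ((Nat.card {i : Fin m // ∃ j, ¬ C ⟨i, j⟩} : ℝ) *
      (Nat.card {j : Fin (size J.1) // ¬ C ⟨J.1, j⟩} : ℝ))

theorem eqRate_nonneg (hp : 0 ≤ p) (C : Job size → Prop) (J : Job size) :
    0 ≤ eqRate p C J := by
  unfold eqRate
  split_ifs <;> positivity

theorem sum_eqRate_le (hp : 0 ≤ p) (C : Job size → Prop) : ∑ J, eqRate p C J ≤ p := by
  classical
  rw [Fintype.sum_sigma]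
  set N : ℝ := (Nat.card {i : Fin m // ∃ j, ¬ C ⟨i, j⟩} : ℝ) with hN
  have inner : ∀ i, ∑ j, eqRate p C ⟨i, j⟩ ≤ if ∃ j, ¬ C ⟨i, j⟩ then p / N else 0 := by
    intro i
    simp only [eqRate, ← hN]
    rw [Finset.sum_ite, Finset.sum_const_zero, zero_add, Finset.sum_const, nsmul_eq_mul,
      Nat.card_eq_fintype_card, Fintype.card_subtype]
    split_ifs with h
    · obtain ⟨j, hj⟩ := h
      have : (0 : ℝ) < (Finset.univ.filter fun j => ¬ C ⟨i, j⟩).card := by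
        exact_mod_cast Finset.card_pos.2 ⟨j, by simpa using hj⟩
      rw [mul_comm N, ← div_div, mul_div_assoc', mul_div_cancel₀ _ this.ne']
    · push Not at h
      simp [h]
  refine (Finset.sum_le_sum fun i _ => inner i).trans ?_
  rw [← Finset.sum_filter, Finset.sum_const, nsmul_eq_mul, ← Fintype.card_subtype,
    ← Nat.card_eq_fintype_card, ← hN]
  rcases eq_or_ne N 0 with h | h
  · simpa [h] using hp
  · rw [mul_div_cancel₀ _ h]

theorem isEqEq_iff {S : Instance size} {σ : Schedule size p} :
    IsEqEq S σ ↔ ∀ J t, 0 ≤ t → σ.alloc J t = eqRate p (fun J => Completed S σ J t) J := by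
  constructor
  · rintro h ⟨i, j⟩ t ht
    unfold eqRate
    split_ifs with hc
    · exact (h i j t ht).2 hc
    · exact (h i j t ht).1 hc
  · intro h i j t ht
    rw [h ⟨i, j⟩ t ht]
    unfold eqRate
    exact ⟨fun hc => if_neg hc, fun hc => if_pos hc⟩

theorem IsEqEq.causal {S S' : Instance size} {σ σ' : Schedule size p} (h : IsEqEq S σ)
    (h' : IsEqEq S' σ') {t : ℝ} (ht : 0 ≤ t)
    (hc : ∀ u, 0 ≤ u → u ≤ t → ∀ J, (Completed S σ J u ↔ Completed S' σ' J u))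
    (J : Job size) : σ.alloc J t = σ'.alloc J t := by
  rw [isEqEq_iff.1 h J t ht, isEqEq_iff.1 h' J t ht]
  congr 1
  exact funext fun J => propext (hc t ht le_rfl J)

theorem IsEqEq.unique {S : Instance size} {σ σ' : Schedule size p} (h : IsEqEq S σ)
    (h' : IsEqEq S σ') (J : Job size) (t : ℝ) (ht : 0 ≤ t) : σ.alloc J t = σ'.alloc J t :=
  alloc_agree (T := t + 1) (fun _ hu hc J => h.causal h' hu hc J) (fun _ _ _ _ => Iff.rfl)
    t ht (lt_add_one t) J

/-- The schedule that follows `σ` before time `T` and has the constant allocations `r` from then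
on. -/
noncomputable def Schedule.switch (σ : Schedule size p) (T : ℝ≥0∞) (r : Job size → ℝ)
    (hr : ∀ J, 0 ≤ r J) (hsum : ∑ J, r J ≤ p) : Schedule size p where
  alloc J t := open Classical in if T ≤ ENNReal.ofReal t then r J else σ.alloc J t
  nonneg J t ht := by
    split_ifs
    exacts [hr J, σ.nonneg J t ht]
  capacity t ht := by
    split_ifs
    exacts [hsum, σ.capacity t ht]
  piecewiseConstant J := by
    classical
    refine PC.congr ((PC.le_ofReal T).comp₂ (σ.pc J) fun c x => if c then r J else x)
      fun t _ => ?_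
    congr

/-- EQ∘EQ can be followed until any number of jobs has completed. -/
theorem exists_partial_eqEq (hp : 0 ≤ p) (S : Instance size) (k : ℕ) :
    ∃ (σ : Schedule size p) (T : ℝ≥0∞),
      (∀ J t, 0 ≤ t → ENNReal.ofReal t < T →
        σ.alloc J t = eqRate p (fun J => Completed S σ J t) J) ∧
      (T = ∞ ∨ k ≤ {J | completionTime S σ J ≤ T}.ncard) := by
  classical
  induction k with
  | zero =>
    exact ⟨⟨fun _ _ => 0, fun _ _ _ => le_rfl, fun _ _ => by simpa using hp,
      fun _ => PC.const 0⟩, 0, fun _ _ _ h => absurd h (by simp), Or.inr (Nat.zero_le _)⟩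
  | succ k ih =>
    obtain ⟨σ, T, hσ, hT⟩ := ih
    rcases eq_or_ne T ∞ with rfl | hTtop
    · exact ⟨σ, ∞, hσ, Or.inl rfl⟩
    have hk := hT.resolve_left hTtop
    lift T to NNReal using hTtop
    have hTr : ((T : NNReal) : ℝ≥0∞) = ENNReal.ofReal T := by simp
    set C : Job size → Prop := fun J => Completed S σ J T with hC
    have hT0 : (0 : ℝ) ≤ T := T.2
    set σ' := σ.switch T (eqRate p C) (eqRate_nonneg hp C) (sum_eqRate_le hp C) with hσ'
    have hbefore : ∀ J (t : ℝ), 0 ≤ t → t < T → σ.alloc J t = σ'.alloc J t := by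
      intro J t _ htT
      have : ¬ (T : ℝ≥0∞) ≤ ENNReal.ofReal t := by
        rw [hTr, ENNReal.ofReal_le_ofReal_iff', not_or]
        exact ⟨not_le.2 htT, fun h => by linarith⟩
      simp [hσ', Schedule.switch, this]
    have hcompl : ∀ J (t : ℝ), 0 ≤ t → t ≤ T → (Completed S σ J t ↔ Completed S σ' J t) :=
      fun J t ht htT => completed_congr ht fun s hs hst => hbefore J s hs (hst.trans_le htT)
    -- The value `∞` removes the jobs already completed at `T`, so that `⨅ J, f J` is the next
    -- completion time under the constant rates.
    set f : Job size → ℝ≥0∞ := fun J => if C J then ∞ else completionTime S σ' J with hf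
    have hle : ∀ J, (T : ℝ≥0∞) ≤ f J := by
      intro J
      simp only [hf]
      split_ifs with h
      · exact le_top
      · have : ¬ Completed S σ' J T := fun h' => h ((hcompl J T hT0 le_rfl).2 h')
        rw [hTr]
        exact (not_le.1 this).le
    refine ⟨σ', ⨅ J, f J, fun J t ht htT => ?_, ?_⟩
    · rcases lt_or_ge t T with htT' | htT'
      · rw [← hbefore J t ht htT', hσ J t ht
          (by rw [hTr]; exact (ENNReal.ofReal_lt_ofReal_iff_of_nonneg ht).2 htT')]
        congr 1
        exact funext fun J => propext (hcompl J t ht htT'.le)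
      · have hle' : (T : ℝ≥0∞) ≤ ENNReal.ofReal t := hTr ▸ ENNReal.ofReal_le_ofReal htT'
        have : σ'.alloc J t = eqRate p C J := by simp [hσ', Schedule.switch, hle']
        rw [this]
        congr 1
        refine funext fun J => propext ⟨fun h => ((hcompl J T hT0 le_rfl).1 h).mono htT',
          fun h => ?_⟩
        by_contra hn
        have h1 : ENNReal.ofReal t < f J := htT.trans_le (iInf_le _ J)
        simp only [hf, if_neg hn] at h1
        exact not_le.2 h1 h
    · by_cases htop : (⨅ J, f J) = ∞
      · exact Or.inl htop
      right
      have hne : Nonempty (Job size) := by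
        by_contra h
        rw [not_nonempty_iff] at h
        exact htop (by simp)
      obtain ⟨J₀, hJ₀⟩ := exists_eq_ciInf_of_finite (f := f)
      have hJ₀C : ¬ C J₀ := fun h => htop (by rw [← hJ₀]; simp [hf, h])
      -- A minimizer `J₀` of `f` is a new completed job.
      refine Nat.succ_le_of_lt (lt_of_le_of_lt hk (Set.ncard_lt_ncard ?_ (Set.toFinite _)))
      refine ⟨fun J (hJ : completionTime S σ J ≤ _) => ?_, fun hs => hJ₀C ?_⟩
      · have : Completed S σ' J T := (hcompl J T hT0 le_rfl).1 (by rwa [hTr] at hJ)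
        exact (le_of_le_of_eq this hTr.symm).trans (le_iInf hle)
      · have : completionTime S σ J₀ ≤ T := hs (show completionTime S σ' J₀ ≤ _ by
          rw [← hJ₀]; simp [hf, hJ₀C])
        rwa [hTr] at this

theorem exists_isEqEq (hp : 0 ≤ p) (S : Instance size) : ∃ σ : Schedule size p, IsEqEq S σ := by
  obtain ⟨σ, T, hσ, hT⟩ := exists_partial_eqEq hp S (Nat.card (Job size) + 1)
  have hT' : T = ∞ := hT.resolve_right fun h => by
    have := Set.ncard_le_card {J | completionTime S σ J ≤ T}
    omega
  subst hT'
  exact ⟨σ, isEqEq_iff.2 fun J t ht => hσ J t ht ENNReal.ofReal_lt_top⟩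

theorem exists_eqEq_algorithm (hp : 0 ≤ p) : ∃ A : NonClairvoyantAlgorithm p,
    ∀ (m : ℕ) (size : Fin m → ℕ) (S : Instance size), IsEqEq S (A.schedule S) :=
  ⟨⟨fun S => (exists_isEqEq hp S).choose, fun S S' _ ht hc =>
    (exists_isEqEq hp S).choose_spec.causal (exists_isEqEq hp S').choose_spec ht hc⟩,
    fun _ _ S => (exists_isEqEq hp S).choose_spec⟩

end EqEq

/-! ### The deterministic lower bound -/

section LowerBound

variable {m : ℕ} {size : Fin m → ℕ} {p : ℝ}

theorem Schedule.sum_integral_le (σ : Schedule size p) (F : Finset (Job size)) {a b : ℝ}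
    (ha : 0 ≤ a) (hab : a ≤ b) : ∑ J ∈ F, ∫ s in a..b, σ.alloc J s ≤ p * (b - a) := by
  rw [← PC.integral_sum σ.pc ha (ha.trans hab)]
  calc ∫ t in a..b, ∑ J ∈ F, σ.alloc J t ≤ ∫ _ in a..b, p :=
        (PC.sum σ.pc).integral_mono (PC.const p) ha hab fun t hat _ =>
          (Finset.sum_le_sum_of_subset_of_nonneg (Finset.subset_univ F)
            fun J _ _ => σ.nonneg J t (ha.trans hat)).trans (σ.capacity t (ha.trans hat))
    _ = p * (b - a) := by rw [intervalIntegral.integral_const, smul_eq_mul, mul_comm]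

/-- Fully parallelizable work. -/
def parPhase (w : NNReal) : Phase where
  work := w
  work_nonneg := w.2
  speedup ρ := ρ
  speedup_nonneg _ h := h
  nondecreasing _ _ _ h := h
  sublinear ρ ρ' h h' := by rw [div_self h.ne', div_self (h.trans h').ne']

/-- One unit of sequential work. -/
def seqPhase : Phase where
  work := 1
  work_nonneg := zero_le_one
  speedup _ := 1
  speedup_nonneg _ _ := zero_le_one
  nondecreasing _ _ _ _ := le_rfl
  sublinear _ _ h h' := one_div_le_one_div_of_le h h'.le

/-- The instance whose job `J` consists of the parallel work `w J` and one unit of sequential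
work. -/
def parSeq (w : Job size → NNReal) : Instance size := fun J => [parPhase (w J), seqPhase]

/-- The delay by 1 is what hides the parallel work from the algorithm: a completion at `u` only
reveals what was processed by `u - 1`. -/
theorem completed_parSeq_iff {w : Job size → NNReal} {σ : Schedule size p} {J : Job size}
    {u : ℝ} (hu : 0 ≤ u) :
    Completed (parSeq w) σ J u ↔ 1 ≤ u ∧ (w J : ℝ) ≤ ∫ s in (0 : ℝ)..(u - 1), σ.alloc J s := by
  have h1 : ∀ v : ℝ, 0 ≤ v → (phaseCompletion (σ.alloc J) 0 (parPhase (w J)) ≤ ENNReal.ofReal v ↔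
      (w J : ℝ) ≤ ∫ s in (0 : ℝ)..v, σ.alloc J s) := fun v hv => by
    rw [phaseCompletion_le_iff (σ.pc J) (σ.nonneg J) hv]
    simp [parPhase]
  change phaseCompletion (σ.alloc J) (phaseCompletion (σ.alloc J) 0 (parPhase (w J))) seqPhase ≤ _
    ↔ _
  rw [phaseCompletion_le_iff (σ.pc J) (σ.nonneg J) hu]
  set b := phaseCompletion (σ.alloc J) 0 (parPhase (w J))
  simp only [seqPhase, intervalIntegral.integral_const, smul_eq_mul, mul_one]
  constructor
  · rintro ⟨hb, hbu⟩
    have hb0 : 0 ≤ b.toReal := ENNReal.toReal_nonneg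
    have hu1 : 1 ≤ u := by linarith
    refine ⟨hu1, (h1 _ (by linarith)).1 ?_⟩
    exact (ENNReal.le_ofReal_iff_toReal_le (ne_top_of_le_ne_top ENNReal.ofReal_ne_top hb)
      (by linarith)).2 (by linarith)
  · rintro ⟨hu1, hw⟩
    have hb := (h1 _ (by linarith)).2 hw
    have := ENNReal.toReal_le_of_le_ofReal (by linarith) hb
    exact ⟨hb.trans (ENNReal.ofReal_le_ofReal (by linarith)), by linarith⟩

/-- Jobs whose parallel work has not been processed by time `r` do not complete by time `r + 1`,
so the amount of this work cannot influence the algorithm before that time. -/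
theorem parSeq_agree (A : NonClairvoyantAlgorithm p) {w w' : Job size → NNReal} {r : ℝ}
    (h : ∀ J, w J = w' J ∨
      ((∫ s in (0 : ℝ)..r, (A.schedule (parSeq w)).alloc J s) < w J ∧
        (∫ s in (0 : ℝ)..r, (A.schedule (parSeq w)).alloc J s) < w' J)) :
    ∀ t, 0 ≤ t → t < r + 1 → ∀ J,
      (A.schedule (parSeq w)).alloc J t = (A.schedule (parSeq w')).alloc J t := by
  set σ := A.schedule (parSeq w) with hσ
  refine alloc_agree (S := parSeq w) (S' := parSeq w')
    (fun t ht hc => A.nonclairvoyant _ _ t ht hc) fun u hu hur J => ?_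
  rw [completed_parSeq_iff hu, completed_parSeq_iff hu]
  refine and_congr_right fun hu1 => ?_
  rcases h J with h | ⟨h, h'⟩
  · rw [h]
  · have := (σ.pc J).integral_mono_right (σ.nonneg J) le_rfl (sub_nonneg.2 hu1)
      (show u - 1 ≤ r by linarith)
    exact iff_of_false (by linarith) (by linarith)

theorem integral_congr_of_agree {f g : ℝ → ℝ} {a b T : ℝ} (h : ∀ t, 0 ≤ t → t < T → f t = g t)
    (ha : 0 ≤ a) (hab : a ≤ b) (hb : b ≤ T) : ∫ s in a..b, f s = ∫ s in a..b, g s := by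
  refine intervalIntegral.integral_congr_uIoo fun t ht => ?_
  rw [Set.uIoo_of_le hab] at ht
  exact h t (ha.trans ht.1.le) (ht.2.trans_le hb)

theorem lt_setflowtime_of_integral_lt {w : Job size → NNReal} {σ : Schedule size p}
    {J : Job size} {r : ℝ} (hr : 0 ≤ r) (h : (∫ s in (0 : ℝ)..r, σ.alloc J s) < w J) :
    ENNReal.ofReal (r + 1) < setflowtime (parSeq w) σ := by
  have h1 : ENNReal.ofReal (r + 1) < completionTime (parSeq w) σ J := by
    by_contra! hc
    have := ((completed_parSeq_iff (by linarith)).1 hc).2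
    rw [add_sub_cancel_right] at this
    linarith
  obtain ⟨i, j⟩ := J
  calc _ < _ := h1
    _ ≤ setCompletionTime (parSeq w) σ i :=
        le_iSup (fun j => completionTime (parSeq w) σ ⟨i, j⟩) j
    _ ≤ _ := Finset.single_le_sum (f := fun i => setCompletionTime (parSeq w) σ i)
        (fun _ _ => zero_le) (Finset.mem_univ i)

/-- Allocations proportional to the works finish all parallel work at `V / p`; the sequential units
then run simultaneously without needing processors. -/
theorem OPT_parSeq_le {size : Fin 1 → ℕ} (hp : 0 < p) (w : Job size → NNReal) :
    OPT p (parSeq w) ≤ ENNReal.ofReal (1 + (∑ J, (w J : ℝ)) / p) := by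
  set V : ℝ := ∑ J, (w J : ℝ) with hV
  have hV0 : 0 ≤ V := Finset.sum_nonneg fun J _ => (w J).2
  let τ : Schedule size p :=
    { alloc := fun J _ => w J * (p / V)
      nonneg := fun J _ _ => by positivity
      capacity := fun _ _ => by
        rw [← Finset.sum_mul, ← hV]
        rcases eq_or_ne V 0 with h | h
        · simpa [h] using hp.le
        · exact (mul_div_cancel₀ p h).le
      piecewiseConstant := fun J => PC.const _ }
  have hτ : ∀ J, completionTime (parSeq w) τ J ≤ ENNReal.ofReal (1 + V / p) := by
    intro J
    refine (completed_parSeq_iff (by positivity)).2 ⟨by simp; positivity, ?_⟩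
    simp only [τ, add_sub_cancel_left, intervalIntegral.integral_const, sub_zero, smul_eq_mul]
    rcases eq_or_ne V 0 with h | h
    · have := Finset.single_le_sum (f := fun J => (w J : ℝ)) (fun J _ => (w J).2)
        (Finset.mem_univ J)
      rw [← hV, h] at this
      simpa [h] using this
    · apply le_of_eq
      field_simp
  refine (iInf₂_le τ fun J => (hτ J).trans_lt ENNReal.ofReal_lt_top).trans ?_
  rw [setflowtime, Fin.sum_univ_one]
  exact iSup_le fun j => hτ _

/-- The adaptive adversary against a deterministic algorithm. -/
theorem deterministic_adversary {q : NNReal} (hq : 0 < q) {k L : ℕ} (hk : 2 ≤ k)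
    (hcard : k ^ L ≤ Fintype.card (Job size)) (A : NonClairvoyantAlgorithm (q : ℝ)) :
    ∃ w : Job size → NNReal, (∑ J, w J) ≤ (L + 1) * (4 * q / k) ∧
      ENNReal.ofReal (L + 1) < setflowtime (parSeq w) (A.schedule (parSeq w)) := by
  classical
  -- Chosen so that `k ^ (L - r)` jobs of work `W r` cost the same amount `4 * q / k` in every
  -- round.
  set W : ℕ → NNReal := fun r => 4 * q * k ^ r / k ^ (L + 1) with hW
  have hk0 : (0 : NNReal) < k := by exact_mod_cast (by omega : 0 < k)
  have hkR : (2 : ℝ) ≤ k := by exact_mod_cast hk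
  have hqR : (0 : ℝ) < q := hq
  have hWpos : ∀ r, 0 < W r := fun r => by positivity
  have hWmono : Monotone W := fun r s h => by
    simp only [hW]
    gcongr
    exact_mod_cast (by omega : 1 ≤ k)
  have hcost : ∀ r, r ≤ L → (k : NNReal) ^ (L - r) * W r = 4 * q / k := fun r hr => by
    have : (k : NNReal) ^ (L + 1) = k ^ (L - r) * k ^ r * k := by
      rw [← pow_add, Nat.sub_add_cancel hr, pow_succ]
    simp only [hW, this]
    field_simp
  -- Invariant after `r` rounds: `F` holds the undecided jobs, provisionally of maximal work `W L`,
  -- each of which has received less than `W r`; the works outside `F` are final.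
  have key : ∀ r, r ≤ L → ∃ (w : Job size → NNReal) (F : Finset (Job size)),
      F.card = k ^ (L - r) ∧ (∀ J ∈ F, w J = W L) ∧
      (∑ J ∈ Fᶜ, w J) ≤ r * (4 * q / k) ∧
      ∀ J ∈ F, (∫ s in (0 : ℝ)..r, (A.schedule (parSeq w)).alloc J s) < W r := by
    intro r
    induction r with
    | zero =>
      intro _
      obtain ⟨F, -, hF⟩ := Finset.exists_subset_card_eq
        (show k ^ L ≤ (Finset.univ : Finset (Job size)).card by simpa using hcard)
      refine ⟨fun J => if J ∈ F then W L else 0, F, by simpa using hF, fun J hJ => if_pos hJ,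
        ?_, fun J _ => by simpa using hWpos 0⟩
      rw [Finset.sum_eq_zero fun J hJ => if_neg (Finset.mem_compl.1 hJ)]
      simp
    | succ r ih =>
      intro hr
      obtain ⟨w, F, hF, hwF, hwsum, hint⟩ := ih (by omega)
      set σ := A.schedule (parSeq w) with hσ
      set win : Job size → ℝ := fun J => ∫ s in (r : ℝ)..(r + 1 : ℝ), σ.alloc J s with hwin
      have hwin0 : ∀ J, 0 ≤ win J := fun J =>
        PC.integral_nonneg (σ.nonneg J) (Nat.cast_nonneg r) (by linarith)
      have hpow : k ^ (L - r) = k * k ^ (L - (r + 1)) := by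
        rw [← pow_succ']
        congr 1
        omega
      -- Twice the average that the jobs of `F` can receive in one time unit. By Markov's inequality
      -- at most half of them receive that much, and the other half suffices because `k ≥ 2`.
      set θ : ℝ := 2 * q / k ^ (L - r) with hθ
      have hkr : (0 : ℝ) < (k : ℝ) ^ (L - r) := by positivity
      set bad := F.filter fun J => θ ≤ win J with hbad
      set good := F.filter fun J => ¬ θ ≤ win J with hgood
      have hsplit : bad.card + good.card = k ^ (L - r) := by
        rw [← hF]
        exact Finset.card_filter_add_card_filter_not _
      have hbadcard : 2 * bad.card ≤ k ^ (L - r) := by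
        have h1 : (bad.card : ℝ) * θ ≤ q := by
          calc (bad.card : ℝ) * θ ≤ ∑ J ∈ bad, win J := by
                rw [← nsmul_eq_mul]
                exact Finset.card_nsmul_le_sum _ _ _ fun J hJ => (Finset.mem_filter.1 hJ).2
            _ ≤ q * ((r + 1 : ℝ) - r) :=
                σ.sum_integral_le bad (Nat.cast_nonneg r) (by linarith)
            _ = q := by ring
        have h2 : (2 * bad.card : ℝ) ≤ k ^ (L - r) := by
          rw [hθ, mul_div_assoc', div_le_iff₀ hkr] at h1
          nlinarith
        exact_mod_cast h2
      have hgoodcard : k ^ (L - (r + 1)) ≤ good.card := by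
        have : 2 * k ^ (L - (r + 1)) ≤ k ^ (L - r) := by
          rw [hpow]
          exact Nat.mul_le_mul_right _ hk
        omega
      obtain ⟨F', hF'good, hF'card⟩ := Finset.exists_subset_card_eq hgoodcard
      have hF'F : F' ⊆ F := hF'good.trans (Finset.filter_subset _ _)
      set w' : Job size → NNReal := fun J => if J ∈ F \ F' then W r else w J with hw'
      -- Lowering the work of discarded jobs to `W r` goes unnoticed before time `r + 1`, since they
      -- have received less than `W r` by time `r`.
      have hagree := parSeq_agree A (w := w) (w' := w') (r := r) (fun J => by
        by_cases hJ : J ∈ F \ F'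
        · right
          have hJF := (Finset.mem_sdiff.1 hJ).1
          have h1 := hint J hJF
          have h2 : ((W r : NNReal) : ℝ) ≤ W L := NNReal.coe_le_coe.2 (hWmono (by omega))
          have e1 : w' J = W r := if_pos hJ
          rw [hwF J hJF, e1]
          exact ⟨h1.trans_le h2, h1⟩
        · left
          exact (if_neg hJ).symm)
      refine ⟨w', F', hF'card, fun J hJ => ?_, ?_, fun J hJ => ?_⟩
      · rw [← hwF J (hF'F hJ)]
        exact if_neg fun h => (Finset.mem_sdiff.1 h).2 hJ
      · have hc : F'ᶜ = Fᶜ ∪ F \ F' := by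
          ext J
          simp only [Finset.mem_compl, Finset.mem_union, Finset.mem_sdiff]
          have := @hF'F J
          tauto
        have hd : Disjoint Fᶜ (F \ F') := by
          rw [Finset.disjoint_left]
          intro J h1 h2
          exact (Finset.mem_compl.1 h1) (Finset.mem_sdiff.1 h2).1
        rw [hc, Finset.sum_union hd]
        have h1 : ∑ J ∈ Fᶜ, w' J = ∑ J ∈ Fᶜ, w J := Finset.sum_congr rfl fun J hJ =>
          if_neg fun h => (Finset.mem_compl.1 hJ) (Finset.mem_sdiff.1 h).1
        have h2 : ∑ J ∈ F \ F', w' J ≤ 4 * q / k := by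
          rw [Finset.sum_congr rfl fun J hJ => (if_pos hJ : w' J = W r), Finset.sum_const,
            nsmul_eq_mul, ← hcost r (by omega)]
          gcongr
          have := Finset.card_le_card (Finset.sdiff_subset : F \ F' ⊆ F)
          rw [hF] at this
          exact_mod_cast this
        rw [h1]
        push_cast
        rw [add_mul, one_mul]
        exact add_le_add hwsum h2
      · have hJF := hF'F hJ
        rw [← integral_congr_of_agree (T := (r : ℝ) + 1) (fun t h1 h2 => hagree t h1 h2 J) le_rfl
          (Nat.cast_nonneg _) (by push_cast; rfl)]
        push_cast
        rw [← (σ.pc J).integral_add le_rfl (Nat.cast_nonneg r) (by positivity)]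
        have h1 := hint J hJF
        have h2 : win J < θ := not_le.1 (Finset.mem_filter.1 (hF'good hJ)).2
        -- `W (r + 1)` equals `2 * θ`, and `W r` is `W (r + 1) / k ≤ θ`.
        have h3 : (W r : ℝ) + θ ≤ W (r + 1) := by
          have e : (k : ℝ) ^ (L + 1) = k ^ (L - r) * k ^ r * k := by
            rw [← pow_add, Nat.sub_add_cancel (by omega), pow_succ]
          have hk0' : (0 : ℝ) < k := hk0
          simp only [hW, hθ]
          push_cast
          rw [pow_succ, ← pow_succ, e]
          have e1 : 4 * (q : ℝ) * k ^ r / (k ^ (L - r) * k ^ r * k) =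
              4 * q / k ^ (L - r) / k := by field_simp
          have e2 : 4 * (q : ℝ) * k ^ (r + 1) / (k ^ (L - r) * k ^ r * k) =
              4 * q / k ^ (L - r) := by rw [pow_succ]; field_simp
          rw [e1, e2]
          have : 4 * (q : ℝ) / k ^ (L - r) / k ≤ 4 * q / k ^ (L - r) / 2 := by gcongr
          have e3 : 4 * (q : ℝ) / k ^ (L - r) = 2 * (2 * q / k ^ (L - r)) := by ring
          linarith
        simp only [hwin] at h2
        linarith
  obtain ⟨w, F, hF, hwF, hwsum, hint⟩ := key L le_rfl
  simp only [Nat.sub_self, pow_zero, Finset.card_eq_one] at hF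
  obtain ⟨J, rfl⟩ := hF
  refine ⟨w, ?_, lt_setflowtime_of_integral_lt (J := J) (Nat.cast_nonneg L) ?_⟩
  · rw [← Finset.sum_add_sum_compl {J}, Finset.sum_singleton, hwF J (by simp), add_comm, add_mul]
    refine add_le_add hwsum ?_
    have := hcost L le_rfl
    simp only [Nat.sub_self, pow_zero, one_mul] at this
    rw [this, one_mul]
  · rw [hwF J (by simp)]
    exact hint J (by simp)

end LowerBound

/-! ### Averages over independent uniform coordinates -/

section Resampling

variable {ι κ : Type*} [DecidableEq ι] [Fintype ι] [Fintype κ]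

/-- Resampling one coordinate preserves averages. -/
theorem sum_update (j : ι) (g : (ι → κ) → ℝ) :
    ∑ x, ∑ a, g (Function.update x j a) = Fintype.card κ * ∑ x, g x := by
  -- Exchanging the coordinate `j` with a fresh sample is a measure-preserving involution.
  have hinv : Function.Involutive
      (fun y : (ι → κ) × κ => (Function.update y.1 j y.2, y.1 j)) := fun y => by simp
  have := Equiv.sum_comp hinv.toPerm (fun y : (ι → κ) × κ => g y.1)
  rw [Fintype.sum_prod_type, Fintype.sum_prod_type] at this
  simpa [Finset.mul_sum] using this

/-- Counting form of independence: an event that ignores the coordinate `j` is independent of that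
coordinate. -/
theorem card_mul_card_of_update {j : ι} {E : (ι → κ) → Prop} [DecidablePred E]
    (hE : ∀ x a, E (Function.update x j a) ↔ E x) (s : Finset κ) [DecidableEq κ] :
    (Fintype.card κ : ℝ) * (Finset.univ.filter fun x => E x ∧ x j ∈ s).card =
      s.card * (Finset.univ.filter E).card := by
  have := sum_update j fun x : ι → κ => if E x ∧ x j ∈ s then (1 : ℝ) else 0
  simp only [hE, Function.update_self, Finset.sum_boole] at this
  rw [← this, Finset.card_filter, Nat.cast_sum, Finset.mul_sum]
  refine Finset.sum_congr rfl fun x _ => ?_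
  by_cases h : E x <;> simp [h]

theorem sum_eval (j : ι) (f : κ → ℝ) :
    (Fintype.card κ : ℝ) * ∑ x : ι → κ, f (x j) = Fintype.card (ι → κ) * ∑ a, f a := by
  rw [← sum_update j fun x => f (x j)]
  simp

end Resampling

/-! ### The random instances against randomized algorithms -/

section Randomized

variable {k L : ℕ}

/-- The parallel work of a job with ticket `z`: it is of the order of `D * k ^ r` for a fraction
`k ^ (-r)` of the tickets. -/
noncomputable def ticketWork (D : NNReal) (z : Fin (k ^ L)) : NNReal :=
  D * ∑ r ∈ Finset.range (L + 1), if (z : ℕ) < k ^ (L - r) then (k : NNReal) ^ r else 0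

theorem le_ticketWork (D : NNReal) {z : Fin (k ^ L)} {r : ℕ} (hr : r ≤ L)
    (hz : (z : ℕ) < k ^ (L - r)) : D * k ^ r ≤ ticketWork D z := by
  refine mul_le_mul_right ?_ D
  have := Finset.single_le_sum
    (f := fun r => if (z : ℕ) < k ^ (L - r) then (k : NNReal) ^ r else 0)
    (fun _ _ => zero_le) (Finset.mem_range.2 (Nat.lt_succ_of_le hr))
  simpa [hz] using this

/-- Each of the `L + 1` scales contributes `D` on average: value `D * k ^ r` with probability `k ^
(-r)`. -/
theorem sum_ticketWork (hk : 1 ≤ k) (D : NNReal) :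
    ∑ z : Fin (k ^ L), (ticketWork D z : ℝ) = D * ((L + 1) * k ^ L) := by
  simp only [ticketWork, NNReal.coe_mul, NNReal.coe_sum]
  rw [← Finset.mul_sum, Finset.sum_comm]
  congr 1
  have : ∀ r ∈ Finset.range (L + 1), ∑ z : Fin (k ^ L),
      (((if (z : ℕ) < k ^ (L - r) then (k : NNReal) ^ r else 0 : NNReal)) : ℝ) = k ^ L := by
    intro r hr
    have hr' : r ≤ L := Nat.lt_succ_iff.1 (Finset.mem_range.1 hr)
    have hle : k ^ (L - r) ≤ k ^ L := Nat.pow_le_pow_right hk (Nat.sub_le _ _)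
    have h1 : (Finset.univ.filter fun z : Fin (k ^ L) => (z : ℕ) < k ^ (L - r)).card =
        k ^ (L - r) := by
      rw [Fin.card_filter_val_lt, min_eq_right hle]
    simp only [apply_ite NNReal.toReal, NNReal.coe_zero]
    rw [← Finset.sum_filter, Finset.sum_const, h1, nsmul_eq_mul]
    push_cast
    rw [← pow_add, Nat.sub_add_cancel hr']
  rw [Finset.sum_congr rfl this]
  simp

theorem ticketWork_le (hk : 2 ≤ k) (D : NNReal) (z : Fin (k ^ L)) :
    (ticketWork D z : ℝ) ≤ D * (2 * k ^ L) := by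
  have hkR : (2 : ℝ) ≤ k := by exact_mod_cast hk
  have h : ∀ M : ℕ, ∑ r ∈ Finset.range (M + 1), (k : ℝ) ^ r ≤ 2 * k ^ M := by
    intro M
    induction M with
    | zero => simp
    | succ M ih =>
      rw [Finset.sum_range_succ, pow_succ]
      have : (0 : ℝ) < k ^ M := by positivity
      nlinarith
  refine le_trans ?_ (mul_le_mul_of_nonneg_left (h L) D.2)
  simp only [ticketWork, NNReal.coe_mul, NNReal.coe_sum]
  refine mul_le_mul_of_nonneg_left (Finset.sum_le_sum fun r _ => ?_) D.2
  split_ifs <;> simp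

variable {m : ℕ} {size : Fin m → ℕ} {p : ℝ}

open Classical in
/-- The instance in which the jobs draw tickets and the job `J` is given the ticket `0`. -/
noncomputable def ticketInstance [NeZero k] (D : NNReal) (J : Job size)
    (x : Job size → Fin (k ^ L)) : Job size → NNReal :=
  fun J' => ticketWork D (Function.update x J 0 J')

open Classical in
/-- Only on few of the random instances a deterministic algorithm has processed the parallel work
of the distinguished job by time `L`. -/
theorem card_spoiled_le [NeZero k] (hk : 2 ≤ k) {D : NNReal} (hD : 0 < D) {q : ℝ}
    (A : NonClairvoyantAlgorithm q) :
    ((Finset.univ.filter fun y : Job size × (Job size → Fin (k ^ L)) =>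
      ¬ (∫ s in (0 : ℝ)..L, (A.schedule (parSeq (ticketInstance D y.1 y.2))).alloc y.1 s) <
        D * k ^ L).card : ℝ) * (D * k / 2) ≤
      L * (Fintype.card (Job size → Fin (k ^ L)) * q) := by
  have hkR : (2 : ℝ) ≤ k := by exact_mod_cast hk
  have hDR : (0 : ℝ) < D := hD
  set I : Job size → (Job size → Fin (k ^ L)) → ℕ → ℝ := fun J x r =>
    ∫ s in (0 : ℝ)..r, (A.schedule (parSeq (ticketInstance D J x))).alloc J s with hI
  -- The distinguished job leaps over a scale during the window `[r, r + 1]`. This event ignores `x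
  -- J`, because the ticket of `J` is overwritten by `0`.
  set E : ℕ → Job size → (Job size → Fin (k ^ L)) → Prop := fun r J x =>
    I J x r < D * k ^ r ∧ ¬ I J x (r + 1) < D * k ^ (r + 1) with hE
  have hEupd : ∀ r J x a, E r J (Function.update x J a) ↔ E r J x := by
    intro r J x a
    have : ticketInstance D J (Function.update x J a) = ticketInstance D J x :=
      funext fun J' => by simp only [ticketInstance, Function.update_idem]
    simp only [hE, hI, this]
  have hstep : ∀ r, r < L →
      ((Finset.univ.filter fun y : Job size × (Job size → Fin (k ^ L)) =>
        E r y.1 y.2).card : ℝ) * (D * k / 2) ≤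
      Fintype.card (Job size → Fin (k ^ L)) * q := by
    intro r hr
    set s : Finset (Fin (k ^ L)) := Finset.univ.filter fun z => (z : ℕ) < k ^ (L - r) with hs
    have hscard : (s.card : ℝ) = k ^ (L - r) := by
      rw [hs, Fin.card_filter_val_lt,
        min_eq_right (Nat.pow_le_pow_right (by omega) (Nat.sub_le _ _))]
      push_cast
      rfl
    set win : (Job size → Fin (k ^ L)) → Job size → ℝ := fun x J =>
      ∫ s in (r : ℝ)..(r + 1 : ℝ), (A.schedule (parSeq fun J => ticketWork D (x J))).alloc J s
      with hwin
    have hwin0 : ∀ x J, 0 ≤ win x J := fun x J =>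
      PC.integral_nonneg ((A.schedule _).nonneg J) (Nat.cast_nonneg r) (by linarith)
    -- If the drawn ticket already guarantees work `D * k ^ r`, the algorithm cannot tell it from
    -- ticket `0` before time `r + 1`. It therefore makes the same leap, of size at least `D * k ^ r
    -- * (k - 1)`, without the replacement.
    have hwinE : ∀ J x, E r J x → x J ∈ s → D * k ^ r * (k / 2) ≤ win x J := by
      rintro J x ⟨h1, h2⟩ hx
      rw [hs, Finset.mem_filter] at hx
      have hagree := parSeq_agree A (w := ticketInstance D J x)
        (w' := fun J => ticketWork D (x J)) (r := r) (fun J' => by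
        rcases eq_or_ne J' J with rfl | hne
        · right
          have ha : (D : ℝ) * k ^ r ≤ ticketWork D (x J') := by
            exact_mod_cast le_ticketWork D hr.le hx.2
          have hb : (D : ℝ) * k ^ r ≤ ticketInstance D J' x J' := by
            have : (((0 : Fin (k ^ L)) : Fin (k ^ L)) : ℕ) < k ^ (L - r) := by
              simpa using pow_pos (by omega) _
            simp only [ticketInstance, Function.update_self]
            exact_mod_cast le_ticketWork D hr.le this
          exact ⟨h1.trans_le hb, h1.trans_le ha⟩
        · left
          simp [ticketInstance, Function.update_of_ne hne])
      have h3 : win x J = I J x (r + 1) - I J x r := by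
        simp only [hwin, hI]
        rw [← integral_congr_of_agree (T := (r : ℝ) + 1) (fun t h1 h2 => hagree t h1 h2 J)
          (Nat.cast_nonneg r) (by linarith) le_rfl, eq_sub_iff_add_eq', Nat.cast_add, Nat.cast_one]
        exact ((A.schedule _).pc J).integral_add le_rfl (Nat.cast_nonneg r) (by positivity)
      rw [h3]
      have h4 : (D : ℝ) * k ^ (r + 1) = D * k ^ r * k := by rw [pow_succ, mul_assoc]
      have h5 : 0 < (D : ℝ) * k ^ r := by positivity
      rw [h4] at h2
      nlinarith [not_lt.1 h2]
    -- A ticket lies in `s` with probability `k ^ (-r)`, independently of `E r J`. This cancels the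
    -- factor `k ^ r` in the size of the leap, and the capacity of a unit window bounds the number
    -- of leaps.
    have hcount : ∀ J, ((Finset.univ.filter (E r J)).card : ℝ) =
        k ^ r * (Finset.univ.filter fun x => E r J x ∧ x J ∈ s).card := by
      intro J
      have h1 := card_mul_card_of_update (hEupd r J) s
      rw [hscard, Fintype.card_fin] at h1
      have h2 : (k : ℝ) ^ L = k ^ (L - r) * k ^ r := by
        rw [← pow_add, Nat.sub_add_cancel hr.le]
      push_cast at h1
      rw [h2, mul_assoc] at h1
      exact (mul_left_cancel₀ (by positivity) h1).symm
    have htot : ((Finset.univ.filter fun y : Job size × (Job size → Fin (k ^ L)) =>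
        E r y.1 y.2).card : ℝ) = ∑ J, ((Finset.univ.filter (E r J)).card : ℝ) := by
      rw [Finset.card_filter, Fintype.sum_prod_type]
      push_cast
      simp [Finset.card_filter]
    rw [htot, Finset.sum_mul]
    calc ∑ J, ((Finset.univ.filter (E r J)).card : ℝ) * (D * k / 2)
        = ∑ J, ∑ x ∈ Finset.univ.filter (fun x => E r J x ∧ x J ∈ s), (D : ℝ) * k ^ r * (k / 2) := by
          refine Finset.sum_congr rfl fun J _ => ?_
          rw [hcount J, Finset.sum_const, nsmul_eq_mul]
          ring
      _ ≤ ∑ J, ∑ x, win x J := by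
          refine Finset.sum_le_sum fun J _ => ?_
          refine (Finset.sum_le_sum fun x hx => ?_).trans
            (Finset.sum_le_sum_of_subset_of_nonneg (Finset.filter_subset _ _)
              fun x _ _ => hwin0 x J)
          obtain ⟨h1, h2⟩ := (Finset.mem_filter.1 hx).2
          exact hwinE J x h1 h2
      _ = ∑ x, ∑ J, win x J := Finset.sum_comm
      _ ≤ ∑ x : Job size → Fin (k ^ L), q * ((r + 1 : ℝ) - r) :=
          Finset.sum_le_sum fun x _ =>
            (A.schedule _).sum_integral_le _ (Nat.cast_nonneg r) (by linarith)
      _ = Fintype.card (Job size → Fin (k ^ L)) * q := by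
          rw [Finset.sum_const, nsmul_eq_mul, Finset.card_univ]
          ring
  -- A job that starts below scale 0 and ends above scale `L` must leap at some round.
  have hsub : (Finset.univ.filter fun y : Job size × (Job size → Fin (k ^ L)) =>
      ¬ I y.1 y.2 L < D * k ^ L) ⊆ (Finset.range L).biUnion fun r =>
        Finset.univ.filter fun y : Job size × (Job size → Fin (k ^ L)) => E r y.1 y.2 := by
    intro y hy
    simp only [Finset.mem_filter, Finset.mem_univ, true_and] at hy
    by_contra hcon
    simp only [Finset.mem_biUnion, Finset.mem_range, Finset.mem_filter, Finset.mem_univ,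
      true_and, not_exists, not_and] at hcon
    have : ∀ r, r ≤ L → I y.1 y.2 r < D * k ^ r := by
      intro r
      induction r with
      | zero => intro _; simpa [hI] using hD
      | succ r ih =>
        intro hr
        by_contra h
        exact hcon r (by omega) ⟨ih (by omega), h⟩
    exact hy (this L le_rfl)
  have hcard := (Finset.card_le_card hsub).trans Finset.card_biUnion_le
  have hcard' : ((Finset.univ.filter fun y : Job size × (Job size → Fin (k ^ L)) =>
      ¬ I y.1 y.2 L < D * k ^ L).card : ℝ) ≤ ∑ r ∈ Finset.range L,
        ((Finset.univ.filter fun y : Job size × (Job size → Fin (k ^ L)) =>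
          E r y.1 y.2).card : ℝ) := by
    exact_mod_cast hcard
  calc _ ≤ (∑ r ∈ Finset.range L,
        ((Finset.univ.filter fun y : Job size × (Job size → Fin (k ^ L)) =>
          E r y.1 y.2).card : ℝ)) * (D * k / 2) :=
        mul_le_mul_of_nonneg_right hcard' (by positivity)
    _ ≤ ∑ r ∈ Finset.range L, Fintype.card (Job size → Fin (k ^ L)) * q := by
        rw [Finset.sum_mul]
        exact Finset.sum_le_sum fun r hr => hstep r (Finset.mem_range.1 hr)
    _ = _ := by simp

end Randomized

/-! ### Averaging over instances and choice of parameters -/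

section LowerBoundAsymptotics

open Filter MeasureTheory

/-- The `n` random tickets account for `n * D * (L + 1)` on average. The planted ticket adds at most
`2 * D * k ^ L ≤ 2 * D * n`. -/
theorem sum_ticketInstance_le {n k L : ℕ} [NeZero k] (hk : 2 ≤ k) (hcard : k ^ L ≤ n)
    (D : NNReal) :
    ∑ y : Job (fun _ : Fin 1 => n) × (Job (fun _ : Fin 1 => n) → Fin (k ^ L)),
      ∑ J, (ticketInstance D y.1 y.2 J : ℝ) ≤
      Fintype.card (Job (fun _ : Fin 1 => n) × (Job (fun _ : Fin 1 => n) → Fin (k ^ L))) *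
        (n * D * (L + 3)) := by
  classical
  have hkL : (0 : ℝ) < (k : ℝ) ^ L := by have := NeZero.pos k; positivity
  have hn : (k : ℝ) ^ L ≤ n := by exact_mod_cast hcard
  have h1 : ∀ y : Job (fun _ : Fin 1 => n) × (Job (fun _ : Fin 1 => n) → Fin (k ^ L)),
      ∑ J, (ticketInstance D y.1 y.2 J : ℝ) ≤
        ∑ J, (ticketWork D (y.2 J) : ℝ) + D * (2 * n) := by
    intro y
    rw [← Finset.sum_erase_add _ _ (Finset.mem_univ y.1),
      ← Finset.sum_erase_add (a := y.1) Finset.univ (fun J => (ticketWork D (y.2 J) : ℝ))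
        (Finset.mem_univ y.1)]
    have e : ∑ J ∈ Finset.univ.erase y.1, (ticketInstance D y.1 y.2 J : ℝ) =
        ∑ J ∈ Finset.univ.erase y.1, (ticketWork D (y.2 J) : ℝ) :=
      Finset.sum_congr rfl fun J hJ => by
        simp only [ticketInstance, Function.update_of_ne (Finset.ne_of_mem_erase hJ)]
    have h2 : (ticketInstance D y.1 y.2 y.1 : ℝ) ≤ D * (2 * n) :=
      (ticketWork_le hk D _).trans (by gcongr)
    have h3 : (0 : ℝ) ≤ ticketWork D (y.2 y.1) := NNReal.coe_nonneg _
    linarith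
  have h2 : ∀ J : Job (fun _ : Fin 1 => n),
      ∑ x : Job (fun _ : Fin 1 => n) → Fin (k ^ L), (ticketWork D (x J) : ℝ) =
        Fintype.card (Job (fun _ : Fin 1 => n) → Fin (k ^ L)) * (D * (L + 1)) := by
    intro J
    have := sum_eval (ι := Job (fun _ : Fin 1 => n)) J
      (fun z : Fin (k ^ L) => (ticketWork D z : ℝ))
    rw [sum_ticketWork (by omega), Fintype.card_fin, Nat.cast_pow] at this
    apply mul_left_cancel₀ hkL.ne'
    rw [this]
    ring
  have hJ : (Fintype.card (Job (fun _ : Fin 1 => n)) : ℝ) = n := by simp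
  refine (Finset.sum_le_sum fun y _ => h1 y).trans (le_of_eq ?_)
  rw [Finset.sum_add_distrib, Fintype.sum_prod_type, Finset.sum_const, nsmul_eq_mul,
    Finset.card_univ]
  simp only []
  rw [Finset.sum_congr rfl fun J _ => Finset.sum_comm]
  simp only [h2]
  simp only [Finset.sum_const, nsmul_eq_mul, Finset.card_univ, Fintype.card_prod, Nat.cast_mul, hJ]
  ring

/-- The easy direction of Yao's principle: were every instance served within the factor `c`, so
would be the average over `Y`, contradicting the bound for each deterministic algorithm. -/
theorem randomized_adversary {n k L : ℕ} (hk : 2 ≤ k) (hcard : k ^ L ≤ n) {p q B c : ℝ}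
    (hp : 0 < p) (hq : 0 < q) (hB : 0 < B) (hc0 : 0 ≤ c)
    (hc : c * (1 + 2 * B * (q / p) * (L + 3) / k) < (L + 1) * (1 - L / B))
    {Ω : Type*} [MeasurableSpace Ω] (μ : Measure Ω) [IsProbabilityMeasure μ]
    (A : Ω → NonClairvoyantAlgorithm q)
    (hA : ∀ S : Instance (fun _ : Fin 1 => n),
      Measurable fun ω => setflowtime S ((A ω).schedule S)) :
    ∃ S : Instance (fun _ : Fin 1 => n),
      ENNReal.ofReal c * OPT p S < ∫⁻ ω, setflowtime S ((A ω).schedule S) ∂μ := by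
  classical
  have : NeZero k := ⟨by omega⟩
  have hkR : (0 : ℝ) < k := by exact_mod_cast NeZero.pos k
  have hnN : 0 < n := lt_of_lt_of_le (pow_pos (NeZero.pos k) L) hcard
  have hn : (0 : ℝ) < n := by exact_mod_cast hnN
  -- With this scale `card_spoiled_le` makes the fraction of spoiled instances at most `L / B`.
  set D : NNReal := Real.toNNReal (2 * B * q / (k * n)) with hD
  have hDR : (D : ℝ) = 2 * B * q / (k * n) := Real.coe_toNNReal _ (by positivity)
  have hDpos : 0 < D := by
    rw [← NNReal.coe_pos, hDR]
    positivity
  set Y := Job (fun _ : Fin 1 => n) × (Job (fun _ : Fin 1 => n) → Fin (k ^ L)) with hY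
  set C : ℝ := (Fintype.card (Job (fun _ : Fin 1 => n) → Fin (k ^ L)) : ℝ) with hC
  have hCpos : 0 < C := by
    rw [hC]
    exact_mod_cast Fintype.card_pos
  have hM : (Fintype.card Y : ℝ) = n * C := by simp [hY, hC]
  set inst : Y → Instance (fun _ : Fin 1 => n) := fun y => parSeq (ticketInstance D y.1 y.2)
  by_contra! hcon
  have hlow : ∀ ω, ENNReal.ofReal ((L + 1) * (n * C * (1 - L / B))) ≤
      ∑ y, setflowtime (inst y) ((A ω).schedule (inst y)) := by
    intro ω
    set good : Y → Prop := fun y =>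
      (∫ s in (0 : ℝ)..L, ((A ω).schedule (inst y)).alloc y.1 s) < D * k ^ L with hgood
    have hbad := card_spoiled_le (L := L) hk hDpos (A ω) (size := fun _ : Fin 1 => n)
    have hsplit : ((Finset.univ.filter good).card : ℝ) +
        (Finset.univ.filter fun y => ¬ good y).card = n * C := by
      rw [← hM, ← Finset.card_univ]
      exact_mod_cast Finset.card_filter_add_card_filter_not _
    have hb : ((Finset.univ.filter fun y => ¬ good y).card : ℝ) ≤ n * C * (L / B) := by
      have e : (D : ℝ) * k / 2 = B * q / n := by
        rw [hDR]
        field_simp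
      rw [e] at hbad
      have h1 : ((Finset.univ.filter fun y => ¬ good y).card : ℝ) * (B * q / n) ≤
        L * (C * q) := hbad
      rw [mul_div_assoc', div_le_iff₀ hn] at h1
      rw [mul_div_assoc', le_div_iff₀ hB]
      refine le_of_mul_le_mul_right ?_ hq
      linarith
    have hg : n * C * (1 - L / B) ≤ ((Finset.univ.filter good).card : ℝ) := by linarith
    calc ENNReal.ofReal ((L + 1) * (n * C * (1 - L / B)))
        ≤ ENNReal.ofReal ((L + 1) * ((Finset.univ.filter good).card : ℝ)) := by gcongr
      _ = ∑ y ∈ Finset.univ.filter good, ENNReal.ofReal (L + 1) := by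
          rw [mul_comm, ENNReal.ofReal_mul (by positivity), Finset.sum_const, nsmul_eq_mul,
            ENNReal.ofReal_natCast]
      _ ≤ ∑ y ∈ Finset.univ.filter good, setflowtime (inst y) ((A ω).schedule (inst y)) := by
          refine Finset.sum_le_sum fun y hy => ?_
          refine (lt_setflowtime_of_integral_lt (J := y.1) (Nat.cast_nonneg L) ?_).le
          refine lt_of_lt_of_le (Finset.mem_filter.1 hy).2 ?_
          have : (((0 : Fin (k ^ L)) : Fin (k ^ L)) : ℕ) < k ^ (L - L) := by simp
          simp only [ticketInstance, Function.update_self]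
          exact_mod_cast le_ticketWork D le_rfl this
      _ ≤ _ := Finset.sum_le_sum_of_subset (Finset.filter_subset _ _)
  have hopt : ∑ y, OPT p (inst y) ≤
      ENNReal.ofReal (n * C * (1 + 2 * B * (q / p) * (L + 3) / k)) := by
    calc ∑ y, OPT p (inst y)
        ≤ ∑ y : Y, ENNReal.ofReal (1 + (∑ J, (ticketInstance D y.1 y.2 J : ℝ)) / p) :=
          Finset.sum_le_sum fun y _ => OPT_parSeq_le hp _
      _ = ENNReal.ofReal (∑ y : Y, (1 + (∑ J, (ticketInstance D y.1 y.2 J : ℝ)) / p)) :=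
          (ENNReal.ofReal_sum_of_nonneg fun y _ => by positivity).symm
      _ ≤ _ := by
          apply ENNReal.ofReal_le_ofReal
          rw [Finset.sum_add_distrib, ← Finset.sum_div, Finset.sum_const, nsmul_eq_mul, mul_one,
            Finset.card_univ, hM, mul_add, mul_one]
          have h1 : ∑ y : Y, ∑ J, (ticketInstance D y.1 y.2 J : ℝ) ≤
            Fintype.card Y * (n * D * (L + 3)) := sum_ticketInstance_le (L := L) hk hcard D
          rw [hM, hDR] at h1
          have h2 := div_le_div_of_nonneg_right h1 hp.le
          refine (add_le_add_right h2 (n * C)).trans (le_of_eq ?_)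
          field_simp
  have hmain : ENNReal.ofReal ((L + 1) * (n * C * (1 - L / B))) ≤
      ENNReal.ofReal (c * (n * C * (1 + 2 * B * (q / p) * (L + 3) / k))) := by
    calc ENNReal.ofReal ((L + 1) * (n * C * (1 - L / B)))
        = ∫⁻ _, ENNReal.ofReal ((L + 1) * (n * C * (1 - L / B))) ∂μ := by simp
      _ ≤ ∫⁻ ω, ∑ y, setflowtime (inst y) ((A ω).schedule (inst y)) ∂μ := lintegral_mono hlow
      _ = ∑ y, ∫⁻ ω, setflowtime (inst y) ((A ω).schedule (inst y)) ∂μ :=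
          lintegral_finsetSum _ fun y _ => hA (inst y)
      _ ≤ ∑ y, ENNReal.ofReal c * OPT p (inst y) := Finset.sum_le_sum fun y _ => hcon _
      _ = ENNReal.ofReal c * ∑ y, OPT p (inst y) := Finset.mul_sum _ _ _ |>.symm
      _ ≤ ENNReal.ofReal c * ENNReal.ofReal _ := by gcongr
      _ = _ := (ENNReal.ofReal_mul hc0).symm
  rw [ENNReal.ofReal_le_ofReal_iff (by positivity)] at hmain
  have hpos : 0 < n * C := by positivity
  nlinarith

theorem log_lt_log_add_one_mul {k n : ℕ} (hk : 2 ≤ k) (hn : n ≠ 0) :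
    Real.log n < (Nat.log k n + 1) * Real.log k := by
  have h := Nat.lt_pow_succ_log_self (b := k) (by omega) n
  have h1 : Real.log n < Real.log ((k : ℝ) ^ (Nat.log k n + 1)) :=
    Real.log_lt_log (by positivity) (by exact_mod_cast h)
  rwa [Real.log_pow, Nat.cast_add, Nat.cast_one] at h1

theorem log_mul_log_le {k n : ℕ} (hk : 0 < k) (hn : n ≠ 0) :
    Nat.log k n * Real.log k ≤ Real.log n := by
  have h := Nat.pow_log_le_self k hn
  rw [← Real.log_pow]
  exact Real.log_le_log (by positivity) (by exact_mod_cast h)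

/-- For large `n`, the parameters of the deterministic adversary. -/
theorem deterministic_parameters {n : ℕ} {s : ℝ} (hx : 100 ≤ Real.log (Real.log n))
    (hs : s ≤ Real.log n / Real.log (Real.log n)) :
    ∃ k L : ℕ, 2 ≤ k ∧ k ^ L ≤ n ∧
      Real.log n / (2 * Real.log (Real.log n)) * (1 + 4 * s * (L + 1) / k) ≤ L + 1 := by
  set x := Real.log (Real.log n) with hxdef
  set l := Real.log n with hl
  have hl0 : 0 < l := by
    by_contra h
    rcases eq_or_lt_of_le (not_lt.1 h) with h | h
    · rw [hxdef, h, Real.log_zero] at hx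
      linarith
    · rw [hl] at h
      exact absurd (Real.log_natCast_nonneg n) (not_le.2 h)
  have hn : n ≠ 0 := by
    rintro rfl
    simp [hl] at hl0
  have hxl : Real.exp x = l := Real.exp_log hl0
  have hlx : x + 1 ≤ l := hxl ▸ Real.add_one_le_exp x
  have hl101 : 101 ≤ l := by linarith
  -- The exponent 2 keeps the total parallel work small for any speed up to `l / x`. The divisor 3
  -- gives `log k ≤ 2 * x - 1`, and the gained 1 absorbs the error `48 / x ^ 2` in `hgoal`.
  set k := ⌊l ^ 2 / 3⌋₊ with hk
  have hk1 : (k : ℝ) ≤ l ^ 2 / 3 := Nat.floor_le (by positivity)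
  have hk2 : l ^ 2 / 3 - 1 < k := Nat.sub_one_lt_floor _
  have hk3 : l ^ 2 / 6 ≤ k := by nlinarith
  have hk4 : l ≤ k := by nlinarith
  have hk5 : 2 ≤ k := by
    have : (2 : ℝ) ≤ k := by linarith
    exact_mod_cast this
  have hk0 : (0 : ℝ) < k := by linarith
  have hlogk : Real.log k ≤ 2 * x - 1 := by
    have h1 := Real.log_le_log hk0 hk1
    rw [Real.log_div (by positivity) (by norm_num), Real.log_pow] at h1
    have h2 : 1 ≤ Real.log 3 := by
      rw [Real.le_log_iff_exp_le (by norm_num)]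
      exact (Real.exp_one_lt_d9.trans (by norm_num)).le
    push_cast at h1
    linarith
  have hlogk' : x ≤ Real.log k := Real.log_le_log hl0 hk4
  set L := Nat.log k n with hL
  have hL1 : l < (L + 1) * Real.log k := log_lt_log_add_one_mul hk5 hn
  have hL2 : L * Real.log k ≤ l := log_mul_log_le (by omega) hn
  have hx0 : 0 < x := by linarith
  have hL3 : (L : ℝ) ≤ l / x := by
    rw [le_div_iff₀ hx0]
    have : (0 : ℝ) ≤ L := Nat.cast_nonneg L
    nlinarith
  have h1lx : 1 ≤ l / x := by
    rw [le_div_iff₀ hx0]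
    linarith
  have hT : 4 * s * (L + 1) / k ≤ 48 / x ^ 2 := by
    calc 4 * s * (L + 1) / k ≤ 4 * (l / x) * (l / x + l / x) / (l ^ 2 / 6) := by gcongr
      _ = 48 / x ^ 2 := by field_simp; norm_num
  refine ⟨k, L, hk5, Nat.pow_log_le_self k hn, ?_⟩
  have hgoal : l / (2 * x) * (1 + 48 / x ^ 2) ≤ l / (2 * x - 1) := by
    rw [div_mul_eq_mul_div, div_le_div_iff₀ (by linarith) (by linarith), mul_assoc]
    refine mul_le_mul_of_nonneg_left ?_ hl0.le
    have e : (1 + 48 / x ^ 2) * (2 * x - 1) = 2 * x - 1 + (96 * x - 48) / x ^ 2 := by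
      field_simp
      ring
    have : (96 * x - 48) / x ^ 2 ≤ 1 := by
      rw [div_le_one (by positivity)]
      nlinarith
    linarith
  calc l / (2 * x) * (1 + 4 * s * (L + 1) / k) ≤ l / (2 * x) * (1 + 48 / x ^ 2) := by gcongr
    _ ≤ l / (2 * x - 1) := hgoal
    _ ≤ L + 1 := by
        rw [div_le_iff₀ (by linarith)]
        have : (0 : ℝ) ≤ L := Nat.cast_nonneg L
        nlinarith

/-- For large `n`, the parameters of the oblivious adversary. -/
theorem randomized_parameters {n : ℕ} {s : ℝ} (hx : 10000 ≤ Real.log (Real.log n))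
    (hs0 : 0 < s) (hs : s ≤ Real.log n / Real.log (Real.log n)) :
    ∃ k L : ℕ, ∃ B : ℝ, 2 ≤ k ∧ k ^ L ≤ n ∧ 0 < B ∧
      Real.log n / (4 * Real.log (Real.log n)) * (1 + 2 * B * s * (L + 3) / k) <
        (L + 1) * (1 - L / B) := by
  set x := Real.log (Real.log n) with hxdef
  set l := Real.log n with hl
  have hl0 : 0 < l := by
    by_contra h
    rcases eq_or_lt_of_le (not_lt.1 h) with h | h
    · rw [hxdef, h, Real.log_zero] at hx
      linarith
    · rw [hl] at h
      exact absurd (Real.log_natCast_nonneg n) (not_le.2 h)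
  have hn : n ≠ 0 := by
    rintro rfl
    simp [hl] at hl0
  have hxl : Real.exp x = l := Real.exp_log hl0
  have hlx : x + 1 ≤ l := hxl ▸ Real.add_one_le_exp x
  have hx0 : 0 < x := by linarith
  -- The exponent must exceed 3, so that `k` dominates `B * s * (L + 3)`, and stay below 4, to leave
  -- slack in the constant. For 7/2 the slack is `8 / 7 = (15 / 14) / (15 / 16)`, which pays for the
  -- error factors `hT` and `h2`.
  set k := ⌊Real.exp (7 / 2 * x)⌋₊ with hk
  have hk1 : (k : ℝ) ≤ Real.exp (7 / 2 * x) := Nat.floor_le (by positivity)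
  have hk2 : Real.exp (7 / 2 * x) - 1 < k := Nat.sub_one_lt_floor _
  have hexp : 3585 * l ^ 3 ≤ Real.exp (7 / 2 * x) := by
    have : Real.exp (7 / 2 * x) = Real.exp (x / 2) * l ^ 3 := by
      rw [← hxl, ← Real.exp_nat_mul, ← Real.exp_add]
      congr 1
      push_cast
      ring
    rw [this]
    gcongr
    have := Real.add_one_le_exp (x / 2)
    linarith
  have hl1 : 1 ≤ l := by linarith
  have hl3 : l ≤ l ^ 3 := le_self_pow₀ hl1 (by norm_num)
  have hk3 : 3584 * l ^ 3 ≤ k := by nlinarith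
  have hk4 : l ≤ k := by nlinarith
  have hk0 : (0 : ℝ) < k := by linarith
  have hk5 : 2 ≤ k := by
    have : (2 : ℝ) ≤ k := by linarith
    exact_mod_cast this
  have hlogk : Real.log k ≤ 7 / 2 * x := (Real.log_le_iff_le_exp hk0).2 hk1
  have hlogk' : x ≤ Real.log k := Real.log_le_log hl0 hk4
  set L := Nat.log k n with hL
  have hL1 : l < (L + 1) * Real.log k := log_lt_log_add_one_mul hk5 hn
  have hL2 : L * Real.log k ≤ l := log_mul_log_le (by omega) hn
  have hL0 : (0 : ℝ) ≤ L := Nat.cast_nonneg L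
  have hL3 : (L : ℝ) ≤ l := by nlinarith
  have hsl : s ≤ l := hs.trans (div_le_self hl0.le (by linarith))
  have hT : 2 * (16 * (L + 1)) * s * (L + 3) / k ≤ 1 / 14 := by
    calc 2 * (16 * (L + 1)) * s * (L + 3) / k
        ≤ 2 * (16 * (l + l)) * l * (l + 3 * l) / (3584 * l ^ 3) := by gcongr; linarith
      _ = 1 / 14 := by field_simp; norm_num
  refine ⟨k, L, 16 * (L + 1), hk5, Nat.pow_log_le_self k hn, by positivity, ?_⟩
  have h1 : l / (4 * x) * (15 / 14) < (L + 1) * (15 / 16) := by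
    have : l < (L + 1) * (7 / 2 * x) := hL1.trans_le (by gcongr)
    rw [div_mul_eq_mul_div, div_lt_iff₀ (by positivity)]
    nlinarith
  have h2 : (L : ℝ) / (16 * (L + 1)) ≤ 1 / 16 := by
    rw [div_le_div_iff₀ (by positivity) (by norm_num)]
    linarith
  calc _ ≤ l / (4 * x) * (15 / 14) := by
        refine mul_le_mul_of_nonneg_left ?_ (by positivity)
        linarith
    _ < (L + 1) * (15 / 16) := h1
    _ ≤ _ := by
        refine mul_le_mul_of_nonneg_left ?_ (by positivity)
        linarith

theorem tendsto_log_log : Tendsto (fun n : ℕ => Real.log (Real.log n)) atTop atTop :=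
  Real.tendsto_log_atTop.comp (Real.tendsto_log_atTop.comp tendsto_natCast_atTop_atTop)

theorem lower_bound_deterministic {n : ℕ} {p s : ℝ} (hx : 100 ≤ Real.log (Real.log n))
    (hs0 : 0 < s) (hs : s ≤ Real.log n / Real.log (Real.log n)) (hp : 0 < p)
    (A : NonClairvoyantAlgorithm (s * p)) {c : ℝ}
    (hc : c < Real.log n / (2 * Real.log (Real.log n))) :
    ∃ S : Instance (fun _ : Fin 1 => n),
      ENNReal.ofReal c * OPT p S < setflowtime S (A.schedule S) := by
  obtain ⟨k, L, hk, hkL, hT⟩ := deterministic_parameters hx hs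
  have hk0 : (0 : ℝ) < k := by exact_mod_cast (by omega : 0 < k)
  have hq0 : 0 < s * p := by positivity
  generalize hq : s * p = q at A hq0
  lift q to NNReal using hq0.le
  obtain ⟨w, hw, hflow⟩ := deterministic_adversary (q := q) (by exact_mod_cast hq0) hk
    (show k ^ L ≤ Fintype.card (Job fun _ : Fin 1 => n) by simpa using hkL) A
  refine ⟨parSeq w, lt_of_le_of_lt ?_ hflow⟩
  have hw' : ∑ J, (w J : ℝ) ≤ (L + 1) * (4 * (s * p) / k) := by
    rw [hq]
    exact_mod_cast hw
  have hR : 0 < Real.log n / (2 * Real.log (Real.log n)) := by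
    have : 0 < Real.log n / Real.log (Real.log n) := hs0.trans_le hs
    rw [mul_comm, ← div_div]
    positivity
  calc ENNReal.ofReal c * OPT p (parSeq w)
      ≤ ENNReal.ofReal (Real.log n / (2 * Real.log (Real.log n))) *
          ENNReal.ofReal (1 + (∑ J, (w J : ℝ)) / p) := by
        gcongr
        exact OPT_parSeq_le hp w
    _ ≤ ENNReal.ofReal (Real.log n / (2 * Real.log (Real.log n))) *
          ENNReal.ofReal (1 + 4 * s * (L + 1) / k) := by
        gcongr ENNReal.ofReal _ * ENNReal.ofReal (1 + ?_)
        rw [div_le_iff₀ hp]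
        refine hw'.trans (le_of_eq ?_)
        ring
    _ ≤ ENNReal.ofReal (L + 1) := by
        rw [← ENNReal.ofReal_mul hR.le]
        exact ENNReal.ofReal_le_ofReal hT

theorem lower_bound_randomized {n : ℕ} {p s : ℝ} (hx : 10000 ≤ Real.log (Real.log n))
    (hs0 : 0 < s) (hs : s ≤ Real.log n / Real.log (Real.log n)) (hp : 0 < p)
    {Ω : Type*} [MeasurableSpace Ω] (μ : Measure Ω) [IsProbabilityMeasure μ]
    (A : Ω → NonClairvoyantAlgorithm (s * p))
    (hA : ∀ S : Instance (fun _ : Fin 1 => n),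
      Measurable fun ω => setflowtime S ((A ω).schedule S)) {c : ℝ}
    (hc : c < Real.log n / (4 * Real.log (Real.log n))) :
    ∃ S : Instance (fun _ : Fin 1 => n),
      ENNReal.ofReal c * OPT p S < ∫⁻ ω, setflowtime S ((A ω).schedule S) ∂μ := by
  obtain ⟨k, L, B, hk, hkL, hB, hT⟩ := randomized_parameters hx hs0 hs
  have hR : 0 ≤ Real.log n / (4 * Real.log (Real.log n)) := by
    have : 0 < Real.log n / Real.log (Real.log n) := hs0.trans_le hs
    rw [mul_comm, ← div_div]
    positivity
  obtain ⟨S, hS⟩ := randomized_adversary hk hkL (q := s * p) hp (by positivity) hB hR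
    (by rwa [mul_div_cancel_right₀ _ hp.ne']) μ A hA
  refine ⟨S, lt_of_le_of_lt ?_ hS⟩
  gcongr

end LowerBoundAsymptotics

open Classical in
/-- The indicator of a proposition, as a real number. -/
noncomputable def ind (P : Prop) : ℝ := if P then 1 else 0

theorem ind_of {P : Prop} (h : P) : ind P = 1 := if_pos h

theorem ind_of_not {P : Prop} (h : ¬ P) : ind P = 0 := if_neg h

theorem ind_nonneg (P : Prop) : 0 ≤ ind P := by
  unfold ind
  split_ifs <;> norm_num

theorem ind_le_one (P : Prop) : ind P ≤ 1 := by
  unfold ind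
  split_ifs <;> norm_num

namespace PC

theorem and {p q : ℝ → Prop} (hp : PC p) (hq : PC q) : PC fun t => p t ∧ q t :=
  hp.comp₂ hq And

theorem or {p q : ℝ → Prop} (hp : PC p) (hq : PC q) : PC fun t => p t ∨ q t :=
  hp.comp₂ hq Or

theorem not {p : ℝ → Prop} (hp : PC p) : PC fun t => ¬ p t :=
  hp.comp Not

theorem ind {p : ℝ → Prop} (hp : PC p) : PC fun t => ind (p t) :=
  hp.comp SetScheduling.ind

theorem mul {f g : ℝ → ℝ} (hf : PC f) (hg : PC g) : PC fun t => f t * g t :=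
  hf.comp₂ hg (· * ·)

theorem add {f g : ℝ → ℝ} (hf : PC f) (hg : PC g) : PC fun t => f t + g t :=
  hf.comp₂ hg (· + ·)

theorem integral_const_mul {f : ℝ → ℝ} (c a b : ℝ) :
    ∫ t in a..b, c * f t = c * ∫ t in a..b, f t :=
  intervalIntegral.integral_const_mul c f

end PC

/-! ### Splitting execution times into sequential and parallel ones -/

section Split

open MeasureTheory

variable {ρ ρ' : ℝ → ℝ} {a a' : ℝ≥0∞} {P : Phase}

/-- The work done while a phase is executed does not exceed the work of the phase. -/
theorem integral_phase_le (hρ : PC ρ) (h0 : ∀ t, 0 ≤ t → 0 ≤ ρ t) {T : ℝ} (hT : 0 ≤ T) :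
    ∫ t in (0 : ℝ)..T, ind (a ≤ ENNReal.ofReal t ∧
      ¬ phaseCompletion ρ a P ≤ ENNReal.ofReal t) * P.speedup (ρ t) ≤ P.work := by
  set b := phaseCompletion ρ a P with hb
  have hg := hρ.comp P.speedup
  have hg0 := P.speedup_comp_nonneg h0
  have hG : PC fun t => ind (a ≤ ENNReal.ofReal t ∧ ¬ b ≤ ENNReal.ofReal t) * P.speedup (ρ t) :=
    ((PC.le_ofReal a).and (PC.le_ofReal b).not).ind.mul hg
  have hzero : ∀ {u v : ℝ}, u ≤ v → (∀ t, u < t → t < v →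
      ¬ (a ≤ ENNReal.ofReal t ∧ ¬ b ≤ ENNReal.ofReal t)) →
      ∫ t in u..v, ind (a ≤ ENNReal.ofReal t ∧ ¬ b ≤ ENNReal.ofReal t) * P.speedup (ρ t) = 0 := by
    intro u v huv h
    rw [intervalIntegral.integral_congr_uIoo (g := fun _ => 0)]
    · simp
    · intro t ht
      rw [Set.uIoo_of_le huv] at ht
      simp only [ind_of_not (h t ht.1 ht.2), zero_mul]
  by_cases haT : a ≤ ENNReal.ofReal T
  swap
  · rw [hzero hT fun t _ htT h => haT (h.1.trans (ENNReal.ofReal_le_ofReal htT.le))]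
    exact P.work_nonneg
  have hatop : a ≠ ∞ := ne_top_of_le_ne_top ENNReal.ofReal_ne_top haT
  have haT' := ENNReal.toReal_le_of_le_ofReal hT haT
  have ha0 : 0 ≤ a.toReal := ENNReal.toReal_nonneg
  have hab : a ≤ b := le_phaseCompletion
  -- `β` is the end of the phase, truncated at `T`.
  obtain ⟨β, hβb, hβT, haβ, hβ⟩ : ∃ β : ℝ, ENNReal.ofReal β ≤ b ∧ β ≤ T ∧ a.toReal ≤ β ∧
      ∀ t, β < t → t < T → b ≤ ENNReal.ofReal t := by
    by_cases hbT : b ≤ ENNReal.ofReal T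
    · have hbtop : b ≠ ∞ := ne_top_of_le_ne_top ENNReal.ofReal_ne_top hbT
      exact ⟨b.toReal, by rw [ENNReal.ofReal_toReal hbtop],
        ENNReal.toReal_le_of_le_ofReal hT hbT, ENNReal.toReal_mono hbtop hab, fun t ht _ =>
        (ENNReal.le_ofReal_iff_toReal_le hbtop (ENNReal.toReal_nonneg.trans ht.le)).2 ht.le⟩
    · exact ⟨T, (not_le.1 hbT).le, le_rfl, haT', fun t h1 h2 => absurd h1 (not_lt.2 h2.le)⟩
  have hβ0 := ha0.trans haβ
  rw [← hG.integral_add le_rfl ha0 hT, ← hG.integral_add ha0 hβ0 hT,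
    hzero ha0 fun t ht hta h => ?_, hzero hβT fun t h1 h2 h => h.2 (hβ t h1 h2), zero_add, add_zero]
  · rw [intervalIntegral.integral_congr_uIoo (g := fun t => P.speedup (ρ t))]
    · by_contra! hlt
      have hmem : P.work ∈ Set.Icc (∫ s in a.toReal..a.toReal, P.speedup (ρ s))
        (∫ s in a.toReal..β, P.speedup (ρ s)) := ⟨by simpa using P.work_nonneg, hlt.le⟩
      obtain ⟨v, hv, hvw⟩ := intermediate_value_Icc haβ
        ((hg.continuousOn_primitive ha0 haβ).mono (Set.Icc_subset_Icc_left ha0)) hmem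
      have hvβ : v < β := lt_of_le_of_ne hv.2 fun h => by
        rw [h] at hvw
        simp only [] at hvw
        linarith
      have hv0 := ha0.trans hv.1
      have h1 : b ≤ ENNReal.ofReal v := (phaseCompletion_le_iff hρ h0 hv0).2
        ⟨(ENNReal.le_ofReal_iff_toReal_le hatop hv0).2 hv.1, hvw.ge⟩
      exact absurd ((hβb.trans h1)) (not_le.2
        ((ENNReal.ofReal_lt_ofReal_iff_of_nonneg hv0).2 hvβ))
    · intro t ht
      rw [Set.uIoo_of_le haβ] at ht
      have ht0 := ha0.trans ht.1.le
      have := ((ENNReal.ofReal_lt_ofReal_iff_of_nonneg ht0).2 ht.2).trans_le hβb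
      simp only [ind_of (And.intro ((ENNReal.le_ofReal_iff_toReal_le hatop ht0).2 ht.1.le)
        (not_le.2 this)), one_mul]
  · exact absurd ((ENNReal.le_ofReal_iff_toReal_le hatop ht.le).1 h.1) (not_le.2 hta)

/-- The times `act` during which a phase is executed with allocation `ρ` split into times that
count as sequential, of total length bounded by that of the execution of the phase with allocation
`ρ'` during `[u, v]`, and times `X` that count as parallel, during which the total allocation is
bounded by that of `ρ'`. -/
theorem threshold_split {act : ℝ → Prop} (hact : PC act) (hρ : PC ρ) (h0 : ∀ t, 0 ≤ t → 0 ≤ ρ t)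
    (hρ' : PC ρ') (h0' : ∀ t, 0 ≤ t → 0 ≤ ρ' t) {u v : ℝ} (hu : 0 ≤ u) (huv : u ≤ v)
    (hwle : P.work ≤ ∫ s in u..v, P.speedup (ρ' s))
    (hwork : ∀ T, 0 ≤ T → ∫ t in (0 : ℝ)..T, ind (act t) * P.speedup (ρ t) ≤ P.work)
    (hnact : P.work = 0 → ∀ t, 0 ≤ t → ¬ act t) :
    ∃ X : ℝ → Prop, PC X ∧ ∀ T, 0 ≤ T →
      ∫ t in (0 : ℝ)..T, ind (act t ∧ ¬ X t) ≤ 10 / 9 * (v - u) ∧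
      ∫ t in (0 : ℝ)..T, ind (act t ∧ X t) * ρ t ≤ 10 * ∫ t in u..v, ρ' t := by
  have hg0 := P.speedup_comp_nonneg h0
  have hg' := hρ'.comp P.speedup
  have hv : 0 ≤ v := hu.trans huv
  set δ := v - u with hδ
  set V := ∫ t in u..v, ρ' t with hV
  have hδ0 : 0 ≤ δ := sub_nonneg.2 huv
  have hV0 : 0 ≤ V := PC.integral_nonneg h0' hu huv
  have hworkPC : PC fun t => ind (act t) * P.speedup (ρ t) := hact.ind.mul (hρ.comp P.speedup)
  have hfalse : ∀ T, ∫ t in (0 : ℝ)..T, ind (act t ∧ False) * ρ t ≤ 10 * V := fun T => by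
    simpa [ind_of_not] using hV0
  have hnotFalse : ∀ t, ind (act t ∧ ¬ False) = ind (act t) := fun t => by simp
  rcases P.work_nonneg.eq_or_lt with hw | hw
  · refine ⟨fun _ => False, PC.const _, fun T hT => ⟨?_, hfalse T⟩⟩
    rw [intervalIntegral.integral_congr (g := fun _ => 0) fun t ht => ?_]
    · simpa using hδ0
    · rw [Set.uIcc_of_le hT] at ht
      exact ind_of_not fun h => hnact hw.symm t ht.1 h.1
  have hδpos : 0 < δ := by
    refine hδ0.lt_of_ne fun h => ?_
    have : u = v := by linarith
    rw [this, intervalIntegral.integral_same] at hwle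
    linarith
  -- If `ρ'` vanishes almost everywhere, the phase progresses at rate `P.speedup 0 > 0` without
  -- processors, and all its times count as sequential.
  rcases hV0.eq_or_lt with hVz | hVpos
  · have hae : ∫ s in u..v, P.speedup (ρ' s) = P.speedup 0 * δ := by
      have h1 := (intervalIntegral.integral_eq_zero_iff_of_le_of_nonneg_ae huv
        (ae_restrict_of_forall_mem measurableSet_Ioc
          fun t ht => h0' t (hu.trans ht.1.le))
        (hρ'.intervalIntegrable hu hv)).1 hVz.symm
      rw [intervalIntegral.integral_congr_ae (g := fun _ => P.speedup 0)]
      · simp [hδ, mul_comm]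
      · rw [Set.uIoc_of_le huv]
        exact (ae_restrict_iff' measurableSet_Ioc).1 (h1.mono fun t ht => by simp [ht])
    have hG0 : 0 < P.speedup 0 := by
      rw [hae] at hwle
      by_contra h
      nlinarith
    refine ⟨fun _ => False, PC.const _, fun T hT => ⟨?_, hfalse T⟩⟩
    simp only [hnotFalse]
    have h1 : P.speedup 0 * ∫ t in (0 : ℝ)..T, ind (act t) ≤ P.speedup 0 * δ := by
      rw [← PC.integral_const_mul]
      refine le_trans (PC.integral_mono ((PC.const _).mul hact.ind) hworkPC le_rfl hT
        fun t ht _ => ?_) ((hwork T hT).trans (hae ▸ hwle))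
      rw [mul_comm]
      exact mul_le_mul_of_nonneg_left (P.nondecreasing _ _ le_rfl (h0 t ht)) (ind_nonneg _)
    have := le_of_mul_le_mul_left h1 hG0
    linarith
  -- Nine times the mean of `ρ'`. Monotonicity and sublinearity give `Γ(r) ≤ Γ(θ) * (1 + r / θ)`, so
  -- the work is at most `Γ(θ) * (δ + V / θ) = Γ(θ) * (10 / 9 * δ)`.
  · set θ := 9 * V / δ with hθ
    have hθpos : 0 < θ := by positivity
    have hwθ : P.work ≤ P.speedup θ * (10 / 9 * δ) := by
      refine hwle.trans ?_
      calc ∫ s in u..v, P.speedup (ρ' s)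
          ≤ ∫ s in u..v, P.speedup θ * (1 + θ⁻¹ * ρ' s) := by
            refine hg'.integral_mono (hρ'.comp fun r => P.speedup θ * (1 + θ⁻¹ * r)) hu huv
              fun t hat _ => ?_
            have hr := h0' t (hu.trans hat)
            have hθ0 := P.speedup_nonneg θ hθpos.le
            rcases le_or_gt (ρ' t) θ with h | h
            · have := P.nondecreasing _ _ hr h
              have : 0 ≤ P.speedup θ * (θ⁻¹ * ρ' t) := by positivity
              linarith
            · have h2 := P.sublinear _ _ hθpos h
              rw [div_le_div_iff₀ (hθpos.trans h) hθpos] at h2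
              have : P.speedup (ρ' t) ≤ P.speedup θ * (θ⁻¹ * ρ' t) := by
                rw [← mul_assoc, mul_right_comm, ← div_eq_mul_inv, le_div_iff₀ hθpos]
                exact h2
              linarith
        _ = P.speedup θ * (δ + θ⁻¹ * V) := by
            rw [intervalIntegral.integral_const_mul, intervalIntegral.integral_add
              intervalIntegrable_const ((hρ'.comp (θ⁻¹ * ·)).intervalIntegrable hu hv),
              intervalIntegral.integral_const_mul]
            simp [hδ, hV]
        _ = P.speedup θ * (10 / 9 * δ) := by
            congr 1
            rw [hθ]
            field_simp
            ring
    have hGθ : 0 < P.speedup θ := by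
      by_contra h
      have : P.speedup θ * (10 / 9 * δ) ≤ 0 :=
        mul_nonpos_of_nonpos_of_nonneg (not_lt.1 h) (by positivity)
      linarith
    have hX : PC fun t => ρ t < θ := hρ.comp (· < θ)
    -- Above the threshold the rate is at least `Γ(θ)`, which bounds the time. Below it the rate is
    -- at least `ρ * Γ(θ) / θ`, which bounds the allocation by `θ * (10 / 9 * δ) = 10 * V`.
    refine ⟨fun t => ρ t < θ, hX, fun T hT => ⟨?_, ?_⟩⟩
    · refine le_of_mul_le_mul_left ?_ hGθ
      rw [← PC.integral_const_mul]
      refine le_trans (PC.integral_mono ((PC.const _).mul (hact.and hX.not).ind) hworkPC le_rfl hT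
        fun t ht _ => ?_) ((hwork T hT).trans hwθ)
      by_cases h : act t ∧ ¬ ρ t < θ
      · rw [ind_of h, ind_of h.1, mul_one, one_mul]
        exact P.nondecreasing _ _ hθpos.le (not_lt.1 h.2)
      · rw [ind_of_not h, mul_zero]
        exact mul_nonneg (ind_nonneg _) (hg0 t ht)
    · have hpos : 0 < P.speedup θ / θ := by positivity
      refine le_of_mul_le_mul_left ?_ hpos
      rw [← PC.integral_const_mul]
      refine le_trans (PC.integral_mono ((PC.const _).mul ((hact.and hX).ind.mul hρ)) hworkPC
        le_rfl hT fun t ht _ => ?_) ((hwork T hT).trans (hwθ.trans (le_of_eq ?_)))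
      · by_cases h : act t ∧ ρ t < θ
        · rw [ind_of h, ind_of h.1, one_mul, one_mul]
          rcases (h0 t ht).eq_or_lt with hz | hz
          · rw [← hz, mul_zero]
            exact P.speedup_nonneg _ le_rfl
          · have := P.sublinear _ _ hz h.2
            rwa [le_div_iff₀ hz] at this
        · rw [ind_of_not h, zero_mul, mul_zero]
          exact mul_nonneg (ind_nonneg _) (hg0 t ht)
      · rw [hθ]
        field_simp

theorem phase_split (hρ : PC ρ) (h0 : ∀ t, 0 ≤ t → 0 ≤ ρ t) (hρ' : PC ρ')
    (h0' : ∀ t, 0 ≤ t → 0 ≤ ρ' t) (hfin : phaseCompletion ρ' a' P ≠ ∞) :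
    ∃ X : ℝ → Prop, PC X ∧ ∀ T, 0 ≤ T →
      ∫ t in (0 : ℝ)..T, ind ((a ≤ ENNReal.ofReal t ∧
        ¬ phaseCompletion ρ a P ≤ ENNReal.ofReal t) ∧ ¬ X t) ≤
          10 / 9 * ((phaseCompletion ρ' a' P).toReal - a'.toReal) ∧
      ∫ t in (0 : ℝ)..T, ind ((a ≤ ENNReal.ofReal t ∧
        ¬ phaseCompletion ρ a P ≤ ENNReal.ofReal t) ∧ X t) * ρ t ≤
          10 * ∫ t in a'.toReal..(phaseCompletion ρ' a' P).toReal, ρ' t := by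
  refine threshold_split (P := P) ((PC.le_ofReal a).and (PC.le_ofReal _).not) hρ h0 hρ' h0'
    ENNReal.toReal_nonneg (ENNReal.toReal_mono hfin le_phaseCompletion)
    ((phaseCompletion_le_iff hρ' h0' ENNReal.toReal_nonneg).1
      (by rw [ENNReal.ofReal_toReal hfin])).2
    (fun T hT => integral_phase_le hρ h0 hT) fun hw t ht h => ?_
  refine h.2 ((phaseCompletion_le_iff hρ h0 ht).2 ⟨h.1, hw ▸ ?_⟩)
  exact PC.integral_nonneg (P.speedup_comp_nonneg h0) ENNReal.toReal_nonneg
    (ENNReal.toReal_le_of_le_ofReal ht h.1)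

theorem le_foldl_phaseCompletion (l : List Phase) (a : ℝ≥0∞) :
    a ≤ l.foldl (phaseCompletion ρ) a := by
  induction l generalizing a with
  | nil => exact le_rfl
  | cons P l ih => exact le_phaseCompletion.trans (ih _)

/-- Each phase is compared with its own execution under `ρ'`, whenever that takes place. The
starting times `a` and `a'` are unrelated, and the bounds telescope along the list. -/
theorem foldl_split (l : List Phase) (hρ : PC ρ) (h0 : ∀ t, 0 ≤ t → 0 ≤ ρ t) (hρ' : PC ρ')
    (h0' : ∀ t, 0 ≤ t → 0 ≤ ρ' t) (a a' : ℝ≥0∞)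
    (hfin : l.foldl (phaseCompletion ρ') a' ≠ ∞) :
    ∃ X : ℝ → Prop, PC X ∧ ∀ T, 0 ≤ T →
      ∫ t in (0 : ℝ)..T, ind ((a ≤ ENNReal.ofReal t ∧
        ¬ l.foldl (phaseCompletion ρ) a ≤ ENNReal.ofReal t) ∧ ¬ X t) ≤
          10 / 9 * ((l.foldl (phaseCompletion ρ') a').toReal - a'.toReal) ∧
      ∫ t in (0 : ℝ)..T, ind ((a ≤ ENNReal.ofReal t ∧
        ¬ l.foldl (phaseCompletion ρ) a ≤ ENNReal.ofReal t) ∧ X t) * ρ t ≤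
          10 * ∫ t in a'.toReal..(l.foldl (phaseCompletion ρ') a').toReal, ρ' t := by
  induction l generalizing a a' with
  | nil =>
    refine ⟨fun _ => False, PC.const _, fun T _ => ?_⟩
    have : ∀ t, ¬ (a ≤ ENNReal.ofReal t ∧ ENNReal.ofReal t < a) := fun t h => not_lt.2 h.1 h.2
    simp [ind_of_not, this]
  | cons P l ih =>
    rw [List.foldl_cons] at hfin
    set c' := phaseCompletion ρ' a' P with hc'
    set c := phaseCompletion ρ a P with hc
    have hc'fin : c' ≠ ∞ := ne_top_of_le_ne_top hfin (le_foldl_phaseCompletion l c')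
    obtain ⟨X₁, hX₁, h₁⟩ := phase_split (a := a) hρ h0 hρ' h0' hc'fin
    obtain ⟨X₂, hX₂, h₂⟩ := ih c c' hfin
    rw [← hc, ← hc'] at h₁
    simp only [List.foldl_cons, ← hc, ← hc']
    set b := l.foldl (phaseCompletion ρ) c
    set b' := l.foldl (phaseCompletion ρ') c'
    have hca : a ≤ c := le_phaseCompletion
    have hbc : c ≤ b := le_foldl_phaseCompletion l c
    have PCa := PC.le_ofReal a
    have PCb := PC.le_ofReal b
    have PCc := PC.le_ofReal c
    have hX : PC fun t => (c ≤ ENNReal.ofReal t ∧ X₂ t) ∨ (¬ c ≤ ENNReal.ofReal t ∧ X₁ t) :=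
      (PCc.and hX₂).or (PCc.not.and hX₁)
    refine ⟨_, hX, fun T hT => ⟨?_, ?_⟩⟩
    · have P1 := ((PCa.and PCc.not).and hX₁.not).ind
      have P2 := ((PCc.and PCb.not).and hX₂.not).ind
      refine (PC.integral_mono ((PCa.and PCb.not).and hX.not).ind
        (P1.add P2) le_rfl hT fun t _ _ => ?_).trans ?_
      · by_cases hct : c ≤ ENNReal.ofReal t
        · have := hca.trans hct
          simp [hct, this, ind_nonneg]
        · have : ¬ b ≤ ENNReal.ofReal t := fun h => hct (hbc.trans h)
          simp [hct, this, ind_nonneg]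
      · rw [intervalIntegral.integral_add (P1.intervalIntegrable le_rfl hT)
          (P2.intervalIntegrable le_rfl hT)]
        linarith [(h₁ T hT).1, (h₂ T hT).1]
    · have P1 := ((PCa.and PCc.not).and hX₁).ind.mul hρ
      have P2 := ((PCc.and PCb.not).and hX₂).ind.mul hρ
      refine (PC.integral_mono (((PCa.and PCb.not).and hX).ind.mul hρ)
        (P1.add P2) le_rfl hT fun t ht _ => ?_).trans ?_
      · have hnn := fun p => mul_nonneg (ind_nonneg p) (h0 t ht)
        by_cases hct : c ≤ ENNReal.ofReal t
        · have := hca.trans hct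
          simp [hct, this, hnn]
        · have : ¬ b ≤ ENNReal.ofReal t := fun h => hct (hbc.trans h)
          simp [hct, this, hnn]
      · rw [intervalIntegral.integral_add (P1.intervalIntegrable le_rfl hT)
          (P2.intervalIntegrable le_rfl hT), ← hρ'.integral_add (a := a'.toReal) (b := c'.toReal)
          ENNReal.toReal_nonneg ENNReal.toReal_nonneg ENNReal.toReal_nonneg]
        linarith [(h₁ T hT).2, (h₂ T hT).2]

variable {m : ℕ} {size : Fin m → ℕ} {p p' : ℝ}

theorem job_split (S : Instance size) (σ : Schedule size p) (τ : Schedule size p') (J : Job size)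
    (hfin : completionTime S τ J ≠ ∞) :
    ∃ X : ℝ → Prop, PC X ∧ ∀ T, 0 ≤ T →
      ∫ t in (0 : ℝ)..T, ind (¬ Completed S σ J t ∧ ¬ X t) ≤
          10 / 9 * (completionTime S τ J).toReal ∧
      ∫ t in (0 : ℝ)..T, ind (¬ Completed S σ J t ∧ X t) * σ.alloc J t ≤
          10 * ∫ t in (0 : ℝ)..(completionTime S τ J).toReal, τ.alloc J t := by
  simpa [Completed, completionTime, jobCompletion] using
    foldl_split (S J) (σ.pc J) (σ.nonneg J) (τ.pc J) (τ.nonneg J) 0 0 hfin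

end Split

/-! ### Bounding the time spent mostly on sequential work -/

section Window

variable {ι : Type*} [Fintype ι] {alive X : ι → ℝ → Prop} {H β : ℝ} {n : ℕ}

/-- Auxiliary form of `integral_sequential_le` for positive bounds. -/
theorem integral_sequential_le_of_pos (hal : ∀ j, PC (alive j)) (hX : ∀ j, PC (X j))
    (hanti : ∀ j s t, s ≤ t → alive j t → alive j s) (hH : 0 < H) (hβ : 1 < β)
    (hseq : ∀ j T, 0 ≤ T → ∫ t in (0 : ℝ)..T, ind (alive j t ∧ ¬ X j t) ≤ H)
    (hn : Fintype.card ι ≤ n) {T : ℝ} (hT : 0 ≤ T) :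
    ∫ t in (0 : ℝ)..T, ind (2 * β * ∑ j, ind (alive j t ∧ X j t) < ∑ j, ind (alive j t)) ≤
      2 * H * (Real.log n / Real.log β + 1) := by
  set N : ℝ → ℝ := fun t => ∑ j, ind (alive j t) with hN
  set q : ℝ → ℝ := fun t => ∑ j, ind (alive j t ∧ X j t) with hq
  set D : ℝ → Prop := fun t => 2 * β * q t < N t with hD
  set d : ℝ → ℝ := fun T => ∫ t in (0 : ℝ)..T, ind (D t) with hd
  have hβ0 : 0 < β := by linarith
  have PCN : PC N := PC.sum fun j => (hal j).ind
  have PCq : PC q := PC.sum fun j => ((hal j).and (hX j)).ind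
  have PCD : PC D := PCq.comp₂ PCN fun x y => 2 * β * x < y
  have hN0 : ∀ t, 0 ≤ N t := fun t => Finset.sum_nonneg fun j _ => ind_nonneg _
  have hq0 : ∀ t, 0 ≤ q t := fun t => Finset.sum_nonneg fun j _ => ind_nonneg _
  have hNanti : ∀ s t, s ≤ t → N t ≤ N s := fun s t hst => Finset.sum_le_sum fun j _ => by
    by_cases h : alive j t
    · rw [ind_of h, ind_of (hanti j s t hst h)]
    · rw [ind_of_not h]
      exact ind_nonneg _
  have hdcont : ∀ t, 0 ≤ t → ContinuousOn d (Set.Icc 0 t) := fun t ht =>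
    PCD.ind.continuousOn_primitive le_rfl ht
  have hd0 : d 0 = 0 := intervalIntegral.integral_same
  have hsub : ∀ s t, 0 ≤ s → s ≤ t → ∫ u in s..t, ind (D u) = d t - d s := fun s t hs hst =>
    eq_sub_of_add_eq' (PCD.ind.integral_add le_rfl hs (hs.trans hst))
  -- A job surviving `2 * H` units of `D`-time is sequential for at most `H` of them, hence parallel
  -- for at least `H`. During `D` at most `N s / (2 * β)` jobs are parallel at once, so double
  -- counting leaves at most `N s / β` survivors.
  have hstep : ∀ s t, 0 ≤ s → s ≤ t → d t - d s = 2 * H → N t * β ≤ N s := by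
    intro s t hs hst hdst
    have ht := hs.trans hst
    have h1 : ∀ j, H * ind (alive j t) ≤
        ∫ u in s..t, ind (D u) * ind (alive j u ∧ X j u) := by
      intro j
      have PC1 := PCD.ind.mul ((hal j).and (hX j)).ind
      have PC2 := ((hal j).and (hX j).not).ind
      by_cases h : alive j t
      · rw [ind_of h, mul_one]
        have h2 : ∫ u in s..t, ind (D u) ≤
            ∫ u in s..t, (ind (D u) * ind (alive j u ∧ X j u) + ind (alive j u ∧ ¬ X j u)) := by
          refine PCD.ind.integral_mono (PC1.add PC2) hs hst fun u _ hut => ?_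
          have hu := hanti j u t hut h
          by_cases hx : X j u
          · rw [ind_of (And.intro hu hx), mul_one]
            linarith [ind_nonneg (alive j u ∧ ¬ X j u)]
          · rw [ind_of_not fun h : alive j u ∧ X j u => hx h.2, ind_of (And.intro hu hx),
              mul_zero, zero_add]
            exact ind_le_one _
        rw [intervalIntegral.integral_add (PC1.intervalIntegrable hs ht)
          (PC2.intervalIntegrable hs ht), hsub s t hs hst, hdst] at h2
        have h3 := hseq j t ht
        rw [← PC2.integral_add le_rfl hs ht] at h3
        have h4 := PC.integral_nonneg (fun u _ => ind_nonneg (alive j u ∧ ¬ X j u)) le_rfl hs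
        linarith
      · rw [ind_of_not h, mul_zero]
        exact PC.integral_nonneg (fun u _ => mul_nonneg (ind_nonneg _) (ind_nonneg _)) hs hst
    have h2 : H * N t ≤ ∫ u in s..t, ind (D u) * q u := by
      calc H * N t = ∑ j, H * ind (alive j t) := Finset.mul_sum _ _ _
        _ ≤ ∑ j, ∫ u in s..t, ind (D u) * ind (alive j u ∧ X j u) :=
            Finset.sum_le_sum fun j _ => h1 j
        _ = ∫ u in s..t, ∑ j, ind (D u) * ind (alive j u ∧ X j u) :=
            (PC.integral_sum (fun j => PCD.ind.mul ((hal j).and (hX j)).ind) hs ht).symm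
        _ = ∫ u in s..t, ind (D u) * q u := by simp only [hq, Finset.mul_sum]
    have h3 : ∫ u in s..t, ind (D u) * q u ≤ ∫ u in s..t, N s / (2 * β) * ind (D u) := by
      refine (PCD.ind.mul PCq).integral_mono ((PC.const _).mul PCD.ind) hs hst fun u hsu _ => ?_
      rw [mul_comm]
      by_cases h : D u
      · rw [ind_of h, mul_one, mul_one, le_div_iff₀ (by positivity), mul_comm]
        exact (le_of_lt h).trans (hNanti s u hsu)
      · rw [ind_of_not h, mul_zero, mul_zero]
    rw [PC.integral_const_mul, hsub s t hs hst, hdst] at h3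
    have h4 : N s / (2 * β) * (2 * H) = H * (N s / β) := by field_simp
    rw [h4] at h3
    rw [← le_div_iff₀ hβ0]
    exact le_of_mul_le_mul_left (h2.trans h3) hH
  have hpow : ∀ (r : ℕ) (t : ℝ), 0 ≤ t → r * (2 * H) ≤ d t → N t * β ^ r ≤ n := by
    intro r
    induction r with
    | zero =>
      intro t _ _
      rw [pow_zero, mul_one]
      calc N t ≤ ∑ _j : ι, (1 : ℝ) := Finset.sum_le_sum fun j _ => ind_le_one _
        _ = Fintype.card ι := by simp
        _ ≤ n := by exact_mod_cast hn
    | succ r ih =>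
      intro t ht hdt
      push_cast at hdt
      have hr0 : 0 ≤ (r : ℝ) * (2 * H) := by positivity
      have hmem : d t - 2 * H ∈ Set.Icc (d 0) (d t) := by
        rw [hd0]
        constructor <;> linarith
      obtain ⟨s, hs, hds⟩ := intermediate_value_Icc ht (hdcont t ht) hmem
      have h1 := ih s hs.1 (by rw [hds]; linarith)
      have h2 := hstep s t hs.1 hs.2 (by rw [hds]; ring)
      calc N t * β ^ (r + 1) = N t * β * β ^ r := by ring
        _ ≤ N s * β ^ r := by gcongr
        _ ≤ n := h1
  have hlogβ : 0 < Real.log β := Real.log_pos hβ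
  have hR0 : 0 ≤ Real.log n / Real.log β := div_nonneg (Real.log_natCast_nonneg n) hlogβ.le
  by_contra! hlt
  obtain ⟨s, hs, hds⟩ := intermediate_value_Icc hT (hdcont T hT)
    (show 2 * H * (Real.log n / Real.log β + 1) ∈ Set.Icc (d 0) (d T) from
      ⟨by rw [hd0]; positivity, hlt.le⟩)
  by_cases hs0 : ∃ j, alive j s
  · obtain ⟨j, hj⟩ := hs0
    have hN1 : 1 ≤ N s := by
      rw [← ind_of hj]
      exact Finset.single_le_sum (f := fun j => ind (alive j s)) (fun j _ => ind_nonneg _)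
        (Finset.mem_univ j)
    set r := ⌊Real.log n / Real.log β⌋₊ + 1 with hr
    have hr1 : Real.log n / Real.log β < r := by
      rw [hr]
      push_cast
      exact Nat.lt_floor_add_one _
    have hr2 : (r : ℝ) ≤ Real.log n / Real.log β + 1 := by
      rw [hr]
      push_cast
      linarith [Nat.floor_le hR0]
    have h1 := hpow r s hs.1 (by rw [hds]; nlinarith)
    have h2 : β ^ r ≤ n := by
      have : 0 < β ^ r := by positivity
      nlinarith
    have h3 := Real.log_le_log (by positivity) h2
    rw [Real.log_pow, ← le_div_iff₀ hlogβ] at h3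
    linarith
  -- Without live jobs the strict inequality in `D` fails, so `d` stops growing.
  · have hnD : ∀ u, s ≤ u → ¬ D u := by
      intro u hu h
      have h1 : N s = 0 := Finset.sum_eq_zero fun j _ => ind_of_not fun h => hs0 ⟨j, h⟩
      have h2 := hNanti s u hu
      have h3 : 2 * β * q u < N u := h
      have : 0 ≤ 2 * β * q u := mul_nonneg (by positivity) (hq0 u)
      linarith
    have h1 := hsub s T hs.1 hs.2
    rw [intervalIntegral.integral_congr (g := fun _ => 0) fun u hu => ?_] at h1
    · rw [intervalIntegral.integral_zero, hds] at h1
      have : 2 * H * (Real.log n / Real.log β + 1) < d T := hlt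
      linarith
    · rw [Set.uIcc_of_le hs.2] at hu
      exact ind_of_not (hnD u hu.1)

/-- If every job is executed sequentially for time at most `H`, then at most a logarithmic multiple
of `H` passes while all but a small fraction of the uncompleted jobs are executed sequentially. -/
theorem integral_sequential_le (hal : ∀ j, PC (alive j)) (hX : ∀ j, PC (X j))
    (hanti : ∀ j s t, s ≤ t → alive j t → alive j s) (hH : 0 ≤ H) (hβ : 1 < β)
    (hseq : ∀ j T, 0 ≤ T → ∫ t in (0 : ℝ)..T, ind (alive j t ∧ ¬ X j t) ≤ H)
    (hn : Fintype.card ι ≤ n) {T : ℝ} (hT : 0 ≤ T) :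
    ∫ t in (0 : ℝ)..T, ind (2 * β * ∑ j, ind (alive j t ∧ X j t) < ∑ j, ind (alive j t)) ≤
      2 * H * (Real.log n / Real.log β + 1) := by
  have hR : 0 < Real.log n / Real.log β + 1 :=
    add_pos_of_nonneg_of_pos (div_nonneg (Real.log_natCast_nonneg n) (Real.log_pos hβ).le)
      one_pos
  refine le_of_forall_pos_le_add fun e he => ?_
  -- For `H = 0` the windows would have length zero, so `H` is perturbed at a total cost of `e`.
  set η := e / (2 * (Real.log n / Real.log β + 1)) with hη
  have hη0 : 0 < η := by positivity
  refine (integral_sequential_le_of_pos hal hX hanti (H := H + η) (by positivity) hβ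
    (fun j T hT => (hseq j T hT).trans (by linarith)) hn hT).trans (le_of_eq ?_)
  rw [hη]
  field_simp

end Window

/-! ### The competitive bound for EQ∘EQ with a free parameter -/

section Upper

variable {m : ℕ} {size : Fin m → ℕ} {p : ℝ}

/-- Of any two indices at least one precedes the other in the order given by `o`, so the ordered
pairs make up at least half of the square. -/
theorem sq_sum_le {ι : Type*} [Fintype ι] (a o : ι → ℝ) (h0 : ∀ i, 0 ≤ a i)
    (h1 : ∀ i, a i ≤ 1) :
    (∑ i, a i) ^ 2 ≤ 2 * ∑ i', ∑ i ∈ Finset.univ.filter (fun i => o i ≤ o i'), a i := by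
  have h : (∑ i, a i) ^ 2 ≤ ∑ i', ∑ i, ((if o i ≤ o i' then a i else 0) +
      (if o i' ≤ o i then a i' else 0)) := by
    rw [sq, Finset.sum_mul_sum]
    refine Finset.sum_le_sum fun i' _ => Finset.sum_le_sum fun i _ => ?_
    have e1 : a i' * a i ≤ a i := mul_le_of_le_one_left (h0 i) (h1 i')
    have e2 : a i' * a i ≤ a i' := mul_le_of_le_one_right (h0 i') (h1 i)
    have := h0 i
    have := h0 i'
    rcases le_total (o i) (o i') with h | h <;> simp only [h, if_true] <;> split_ifs <;> linarith
  refine h.trans (le_of_eq ?_)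
  simp only [Finset.sum_add_distrib, Finset.sum_filter]
  rw [Finset.sum_comm (f := fun i' i => if o i' ≤ o i then a i' else 0)]
  ring

theorem numJobs_eq_sum (S : Instance size) (σ : Schedule size p) (i : Fin m) (t : ℝ) :
    (numJobs S σ i t : ℝ) = ∑ j, ind (¬ Completed S σ ⟨i, j⟩ t) := by
  classical
  rw [numJobs, Nat.card_eq_fintype_card, Fintype.card_subtype, Finset.card_filter]
  push_cast
  refine Finset.sum_congr rfl fun j _ => ?_
  unfold ind
  congr

theorem numSets_eq_sum (S : Instance size) (σ : Schedule size p) (t : ℝ) :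
    (numSets S σ t : ℝ) = ∑ i, ind (∃ j, ¬ Completed S σ ⟨i, j⟩ t) := by
  classical
  rw [numSets, Nat.card_eq_fintype_card, Fintype.card_subtype, Finset.card_filter]
  push_cast
  refine Finset.sum_congr rfl fun i _ => ?_
  unfold ind
  congr

theorem setCompletionTime_le_iff (S : Instance size) (σ : Schedule size p) (i : Fin m) (t : ℝ) :
    ¬ setCompletionTime S σ i ≤ ENNReal.ofReal t ↔ ∃ j, ¬ Completed S σ ⟨i, j⟩ t := by
  rw [setCompletionTime, iSup_le_iff, not_forall]
  rfl

/-- A completion time is the integral of the indicator of being uncompleted. The bound on truncated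
integrals also rules out infinite values: see the horizon `B + 1`. -/
theorem sum_le_of_integral_le {ι : Type*} [Fintype ι] {c : ι → ℝ≥0∞} {B : ℝ}
    (h : ∀ T, 0 ≤ T → ∑ i, ∫ t in (0 : ℝ)..T, ind (¬ c i ≤ ENNReal.ofReal t) ≤ B) :
    ∑ i, c i ≤ ENNReal.ofReal B := by
  have hPC : ∀ i, PC fun t => ind (¬ c i ≤ ENNReal.ofReal t) :=
    fun i => (PC.le_ofReal (c i)).not.ind
  have hB : 0 ≤ B := by simpa using h 0 le_rfl
  have hlow : ∀ i v T, 0 ≤ v → v ≤ T → ENNReal.ofReal v ≤ c i →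
      v ≤ ∫ t in (0 : ℝ)..T, ind (¬ c i ≤ ENNReal.ofReal t) := by
    intro i v T hv hvT hvc
    refine le_trans (le_of_eq ?_) ((hPC i).integral_mono_right (fun _ _ => ind_nonneg _) le_rfl
      hv hvT)
    rw [intervalIntegral.integral_congr_uIoo (g := fun _ => 1)]
    · simp
    · intro t ht
      rw [Set.uIoo_of_le hv] at ht
      refine ind_of (not_le.2 (lt_of_lt_of_le ?_ hvc))
      exact (ENNReal.ofReal_lt_ofReal_iff_of_nonneg ht.1.le).2 ht.2
  have hnn : ∀ i T, 0 ≤ T → 0 ≤ ∫ t in (0 : ℝ)..T, ind (¬ c i ≤ ENNReal.ofReal t) :=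
    fun i T hT => PC.integral_nonneg (fun _ _ => ind_nonneg _) le_rfl hT
  have hfin : ∀ i, c i ≠ ∞ := by
    intro i hi
    have h1 := hlow i (B + 1) (B + 1) (by linarith) le_rfl (by simp [hi])
    have h2 := Finset.single_le_sum (fun i _ => hnn i (B + 1) (by linarith)) (Finset.mem_univ i)
    have h3 := h (B + 1) (by linarith)
    linarith
  have h1 : ∑ i, (c i).toReal ≤ B := by
    refine le_trans (Finset.sum_le_sum fun i _ => ?_) (h (∑ i, (c i).toReal)
      (Finset.sum_nonneg fun i _ => ENNReal.toReal_nonneg))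
    exact hlow i _ _ ENNReal.toReal_nonneg
      (Finset.single_le_sum (fun i _ => ENNReal.toReal_nonneg) (Finset.mem_univ i))
      (by rw [ENNReal.ofReal_toReal (hfin i)])
  rw [← ENNReal.toReal_sum fun i _ => hfin i] at h1
  exact (ENNReal.le_ofReal_iff_toReal_le (ENNReal.sum_ne_top.2 fun i _ => hfin i) hB).2 h1

theorem setCompletionTime_ne_top {S : Instance size} {τ : Schedule size p} (hτ : IsValid S τ)
    (i : Fin m) : setCompletionTime S τ i ≠ ∞ := by
  refine ne_of_lt ?_
  rw [setCompletionTime, ← Finset.sup_univ_eq_iSup]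
  exact (Finset.sup_lt_iff ENNReal.zero_lt_top).2 fun j _ => hτ ⟨i, j⟩

theorem completionTime_le_set (S : Instance size) (τ : Schedule size p) (i : Fin m)
    (j : Fin (size i)) : completionTime S τ ⟨i, j⟩ ≤ setCompletionTime S τ i :=
  le_iSup (fun j => completionTime S τ ⟨i, j⟩) j

/-- Sets that are completed by a schedule before the set `i` receive a bounded allocation. -/
theorem sum_work_le (S : Instance size) (τ : Schedule size p) (i' : Fin m) :
    ∑ i ∈ Finset.univ.filter (fun i => (setCompletionTime S τ i).toReal ≤
      (setCompletionTime S τ i').toReal),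
      ∑ j, ∫ t in (0 : ℝ)..(setCompletionTime S τ i).toReal, τ.alloc ⟨i, j⟩ t ≤
      p * (setCompletionTime S τ i').toReal := by
  have hmono : ∀ J {v w : ℝ}, 0 ≤ v → v ≤ w → ∫ t in (0 : ℝ)..v, τ.alloc J t ≤
      ∫ t in (0 : ℝ)..w, τ.alloc J t := fun J v w hv hvw =>
    (τ.pc J).integral_mono_right (τ.nonneg J) le_rfl hv hvw
  have hnn : ∀ J, 0 ≤ ∫ t in (0 : ℝ)..(setCompletionTime S τ i').toReal, τ.alloc J t :=
    fun J => PC.integral_nonneg (τ.nonneg J) le_rfl ENNReal.toReal_nonneg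
  calc _ ≤ ∑ i ∈ Finset.univ.filter (fun i => (setCompletionTime S τ i).toReal ≤
        (setCompletionTime S τ i').toReal),
        ∑ j, ∫ t in (0 : ℝ)..(setCompletionTime S τ i').toReal, τ.alloc ⟨i, j⟩ t :=
        Finset.sum_le_sum fun i hi => Finset.sum_le_sum fun j _ =>
          hmono _ ENNReal.toReal_nonneg (Finset.mem_filter.1 hi).2
    _ ≤ ∑ i, ∑ j, ∫ t in (0 : ℝ)..(setCompletionTime S τ i').toReal, τ.alloc ⟨i, j⟩ t :=
        Finset.sum_le_sum_of_subset_of_nonneg (Finset.filter_subset _ _)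
          fun i _ _ => Finset.sum_nonneg fun j _ => hnn _
    _ = ∑ J, ∫ t in (0 : ℝ)..(setCompletionTime S τ i').toReal, τ.alloc J t :=
        (Fintype.sum_sigma fun J : Job size =>
          ∫ t in (0 : ℝ)..(setCompletionTime S τ i').toReal, τ.alloc J t).symm
    _ ≤ p * ((setCompletionTime S τ i').toReal - 0) :=
        τ.sum_integral_le _ le_rfl ENNReal.toReal_nonneg
    _ = _ := by rw [sub_zero]

/-- While a non-negligible fraction of the uncompleted jobs of a set is in parallel mode, EQ∘EQ
makes progress with the parallel work of the set. -/
theorem IsEqEq.share_le {S : Instance size} {σ : Schedule size p} (h : IsEqEq S σ) (hp : 0 < p)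
    {X : Job size → ℝ → Prop} {β t : ℝ} (ht : 0 ≤ t) (i : Fin m)
    (hA : ∃ j, ¬ Completed S σ ⟨i, j⟩ t)
    (hpar : (∑ j, ind (¬ Completed S σ ⟨i, j⟩ t)) ≤
      2 * β * ∑ j, ind (¬ Completed S σ ⟨i, j⟩ t ∧ X ⟨i, j⟩ t)) :
    p / numSets S σ t ≤
      2 * β * ∑ j, ind (¬ Completed S σ ⟨i, j⟩ t ∧ X ⟨i, j⟩ t) * σ.alloc ⟨i, j⟩ t := by
  obtain ⟨j₀, hj₀⟩ := hA
  have hNi : 0 < (numJobs S σ i t : ℝ) := by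
    rw [numJobs_eq_sum]
    exact Finset.sum_pos' (fun j _ => ind_nonneg _)
      ⟨j₀, Finset.mem_univ _, by rw [ind_of hj₀]; exact one_pos⟩
  rw [← numJobs_eq_sum] at hpar
  have e : ∀ j, ind (¬ Completed S σ ⟨i, j⟩ t ∧ X ⟨i, j⟩ t) * σ.alloc ⟨i, j⟩ t =
      ind (¬ Completed S σ ⟨i, j⟩ t ∧ X ⟨i, j⟩ t) *
        (p / ((numSets S σ t : ℝ) * (numJobs S σ i t : ℝ))) := by
    intro j
    by_cases hc : ¬ Completed S σ ⟨i, j⟩ t ∧ X ⟨i, j⟩ t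
    · rw [(h i j t ht).1 hc.1]
    · rw [ind_of_not hc, zero_mul, zero_mul]
  simp only [e]
  rw [← Finset.sum_mul, ← mul_assoc]
  calc p / numSets S σ t = numJobs S σ i t *
        (p / ((numSets S σ t : ℝ) * (numJobs S σ i t : ℝ))) := by
        rw [mul_comm (numSets S σ t : ℝ), ← div_div, ← mul_div_assoc, mul_div_cancel₀ _ hNi.ne']
    _ ≤ _ := by gcongr

/-- The integral of the number of live sets is the flow time up to `T`. Times in `D i` are charged
to the completion of set `i` in `τ`; for the other live sets, the shares of all sets that `τ`
finishes no later than `i'` are charged to the capacity of `τ` up to that moment. -/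
theorem IsEqEq.integral_numSets_le {S : Instance size} {σ τ : Schedule size p} (h : IsEqEq S σ)
    (hp : 0 < p) (hτ : IsValid S τ) {n : ℕ} (hn : ∀ i, size i ≤ n) {β : ℝ} (hβ : 1 < β) {T : ℝ}
    (hT : 0 ≤ T) :
    9 / 10 * ∫ t in (0 : ℝ)..T, (numSets S σ t : ℝ) ≤
      (20 / 9 * (Real.log n / Real.log β + 1) + 100 * β) *
        ∑ i, (setCompletionTime S τ i).toReal := by
  have hβ0 : 0 < β := by linarith
  choose X hX hXT using fun J => job_split S σ τ J (hτ J).ne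
  set o : Fin m → ℝ := fun i => (setCompletionTime S τ i).toReal with ho
  have ho0 : ∀ i, 0 ≤ o i := fun i => ENNReal.toReal_nonneg
  have hoJ : ∀ i j, (completionTime S τ ⟨i, j⟩).toReal ≤ o i := fun i j =>
    ENNReal.toReal_mono (setCompletionTime_ne_top hτ i) (completionTime_le_set S τ i j)
  have hal : ∀ J, PC fun t => ¬ Completed S σ J t := fun J => (PC.le_ofReal _).not
  set A : Fin m → ℝ → Prop := fun i t => ∃ j, ¬ Completed S σ ⟨i, j⟩ t with hA
  have PCA : ∀ i, PC (A i) := fun i => (PC.pi fun j => hal ⟨i, j⟩).comp fun x => ∃ j, x j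
  set Ni : Fin m → ℝ → ℝ := fun i t => ∑ j, ind (¬ Completed S σ ⟨i, j⟩ t) with hNi
  set qi : Fin m → ℝ → ℝ := fun i t => ∑ j, ind (¬ Completed S σ ⟨i, j⟩ t ∧ X ⟨i, j⟩ t) with hqi
  have PCNi : ∀ i, PC (Ni i) := fun i => PC.sum fun j => (hal _).ind
  have PCqi : ∀ i, PC (qi i) := fun i => PC.sum fun j => ((hal _).and (hX _)).ind
  set D : Fin m → ℝ → Prop := fun i t => 2 * β * qi i t < Ni i t with hD
  have PCD : ∀ i, PC (D i) := fun i => (PCqi i).comp₂ (PCNi i) fun x y => 2 * β * x < y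
  set par : Fin m → ℝ → Prop := fun i t => A i t ∧ ¬ D i t with hpar
  have PCpar : ∀ i, PC (par i) := fun i => (PCA i).and (PCD i).not
  set N : ℝ → ℝ := fun t => (numSets S σ t : ℝ) with hN
  have hNsum : N = fun t => ∑ i, ind (A i t) := funext fun t => numSets_eq_sum S σ t
  have PCN : PC N := by
    rw [hNsum]
    exact PC.sum fun i => (PCA i).ind
  have hN0 : ∀ t, 0 ≤ N t := fun t => Nat.cast_nonneg _
  have PCshare : ∀ i, PC fun t => ind (par i t) * (p / N t) :=
    fun i => (PCpar i).ind.mul (PCN.comp (p / ·))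
  set V : Fin m → ℝ := fun i => ∑ j, ∫ t in (0 : ℝ)..o i, τ.alloc ⟨i, j⟩ t with hV
  have hseq : ∀ i, ∫ t in (0 : ℝ)..T, ind (D i t) ≤
      2 * (10 / 9 * o i) * (Real.log n / Real.log β + 1) := by
    intro i
    refine integral_sequential_le (fun j => hal ⟨i, j⟩) (fun j => hX ⟨i, j⟩)
      (fun j s t hst h1 h2 => h1 (h2.mono hst)) (mul_nonneg (by norm_num) (ho0 i)) hβ
      (fun j T hT => (hXT ⟨i, j⟩ T hT).1.trans ?_) (by simpa using hn i) hT
    exact mul_le_mul_of_nonneg_left (hoJ i j) (by norm_num)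
  have hshare : ∀ i, ∫ t in (0 : ℝ)..T, ind (par i t) * (p / N t) ≤ 20 * β * V i := by
    intro i
    have PCwork : ∀ j, PC fun t =>
        ind (¬ Completed S σ ⟨i, j⟩ t ∧ X ⟨i, j⟩ t) * σ.alloc ⟨i, j⟩ t :=
      fun j => ((hal _).and (hX _)).ind.mul (σ.pc _)
    calc ∫ t in (0 : ℝ)..T, ind (par i t) * (p / N t)
        ≤ ∫ t in (0 : ℝ)..T, 2 * β *
            ∑ j, ind (¬ Completed S σ ⟨i, j⟩ t ∧ X ⟨i, j⟩ t) * σ.alloc ⟨i, j⟩ t := by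
          refine (PCshare i).integral_mono ((PC.const _).mul (PC.sum PCwork)) le_rfl hT
            fun t ht _ => ?_
          by_cases hc : par i t
          · rw [ind_of hc, one_mul]
            exact h.share_le hp ht i hc.1 (not_lt.1 hc.2)
          · rw [ind_of_not hc, zero_mul]
            exact mul_nonneg (by positivity)
              (Finset.sum_nonneg fun j _ => mul_nonneg (ind_nonneg _) (σ.nonneg _ t ht))
      _ = 2 * β * ∑ j, ∫ t in (0 : ℝ)..T,
            ind (¬ Completed S σ ⟨i, j⟩ t ∧ X ⟨i, j⟩ t) * σ.alloc ⟨i, j⟩ t := by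
          rw [PC.integral_const_mul, PC.integral_sum PCwork le_rfl hT]
      _ ≤ 2 * β * ∑ j, 10 * ∫ t in (0 : ℝ)..o i, τ.alloc ⟨i, j⟩ t := by
          gcongr with j
          refine (hXT ⟨i, j⟩ T hT).2.trans ?_
          gcongr
          exact (τ.pc _).integral_mono_right (τ.nonneg _) le_rfl ENNReal.toReal_nonneg (hoJ i j)
      _ = 20 * β * V i := by
          rw [← Finset.mul_sum]
          ring
  have hpoint : ∀ t, 0 ≤ t → 9 / 10 * N t ≤ ∑ i, ind (D i t) +
      5 / p * ∑ i', ∑ i ∈ Finset.univ.filter (fun i => o i ≤ o i'),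
        ind (par i t) * (p / N t) := by
    intro t _
    set ℓ := ∑ i, ind (par i t) with hℓ
    have hℓ0 : 0 ≤ ℓ := Finset.sum_nonneg fun i _ => ind_nonneg _
    have h1 : N t ≤ ∑ i, ind (D i t) + ℓ := by
      rw [hNsum, hℓ, ← Finset.sum_add_distrib]
      refine Finset.sum_le_sum fun i _ => ?_
      by_cases hD' : D i t
      · rw [ind_of hD']
        linarith [ind_le_one (A i t), ind_nonneg (par i t)]
      · by_cases hA' : A i t
        · rw [ind_of hA', ind_of_not hD', ind_of (show par i t from ⟨hA', hD'⟩), zero_add]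
        · rw [ind_of_not hA']
          exact add_nonneg (ind_nonneg _) (ind_nonneg _)
    have h2 : ℓ ≤ N t := by
      rw [hNsum, hℓ]
      refine Finset.sum_le_sum fun i _ => ?_
      by_cases hc : par i t
      · rw [ind_of hc, ind_of hc.1]
      · rw [ind_of_not hc]
        exact ind_nonneg _
    have h3 := sq_sum_le (fun i => ind (par i t)) o (fun i => ind_nonneg _)
      (fun i => ind_le_one _)
    simp only [← Finset.sum_mul]
    set Q := ∑ i', ∑ i ∈ Finset.univ.filter (fun i => o i ≤ o i'), ind (par i t) with hQ
    have h4 : 5 / p * (Q * (p / N t)) = 5 * Q / N t := by field_simp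
    rw [h4]
    rcases (hN0 t).eq_or_lt with hz | hz
    · rw [← hz] at h1 h2 ⊢
      simp only [div_zero, mul_zero, add_zero]
      linarith
    -- Linearizes the quadratic bound `ℓ ^ 2 ≤ 2 * Q`: the square of `ℓ - N t / 5` is nonnegative.
    -- The sacrificed tenth of `N t` is why the left side carries 9/10.
    · have h5 : ℓ - N t / 10 ≤ 5 * Q / N t := by
        rw [le_div_iff₀ hz]
        have : ℓ ^ 2 ≤ 2 * Q := h3
        nlinarith [sq_nonneg (ℓ - N t / 5)]
      linarith
  have PCseq : PC fun t => ∑ i, ind (D i t) := PC.sum fun i => (PCD i).ind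
  have PCinner : ∀ i', PC fun t => ∑ i ∈ Finset.univ.filter (fun i => o i ≤ o i'),
      ind (par i t) * (p / N t) := fun i' => PC.sum PCshare
  have PCouter : PC fun t => 5 / p * ∑ i', ∑ i ∈ Finset.univ.filter (fun i => o i ≤ o i'),
      ind (par i t) * (p / N t) := (PC.const _).mul (PC.sum PCinner)
  have hwork : ∀ i', ∑ i ∈ Finset.univ.filter (fun i => o i ≤ o i'), V i ≤ p * o i' :=
    fun i' => sum_work_le S τ i'
  calc 9 / 10 * ∫ t in (0 : ℝ)..T, N t
      = ∫ t in (0 : ℝ)..T, 9 / 10 * N t := (PC.integral_const_mul _ _ _).symm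
    _ ≤ ∫ t in (0 : ℝ)..T, (∑ i, ind (D i t) +
          5 / p * ∑ i', ∑ i ∈ Finset.univ.filter (fun i => o i ≤ o i'),
            ind (par i t) * (p / N t)) :=
        ((PC.const _).mul PCN).integral_mono (PCseq.add PCouter) le_rfl hT
          fun t ht _ => hpoint t ht
    _ = (∑ i, ∫ t in (0 : ℝ)..T, ind (D i t)) +
          5 / p * ∑ i', ∑ i ∈ Finset.univ.filter (fun i => o i ≤ o i'),
            ∫ t in (0 : ℝ)..T, ind (par i t) * (p / N t) := by
        rw [intervalIntegral.integral_add (PCseq.intervalIntegrable le_rfl hT)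
          (PCouter.intervalIntegrable le_rfl hT), PC.integral_sum (fun i => (PCD i).ind) le_rfl hT,
          PC.integral_const_mul, PC.integral_sum PCinner le_rfl hT]
        congr 2
        exact Finset.sum_congr rfl fun i' _ => PC.integral_sum PCshare le_rfl hT
    _ ≤ ∑ i, 2 * (10 / 9 * o i) * (Real.log n / Real.log β + 1) +
          5 / p * ∑ i', 20 * β * (p * o i') := by
        refine add_le_add (Finset.sum_le_sum fun i _ => hseq i)
          (mul_le_mul_of_nonneg_left (Finset.sum_le_sum fun i' _ => ?_) (by positivity))
        refine (Finset.sum_le_sum fun i _ => hshare i).trans ?_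
        rw [← Finset.mul_sum]
        exact mul_le_mul_of_nonneg_left (hwork i') (by positivity)
    _ = _ := by
        rw [← Finset.sum_mul, ← Finset.mul_sum, ← Finset.mul_sum, ← Finset.mul_sum,
          ← Finset.mul_sum]
        field_simp
        ring

/-- Dividing by the positive finite constant allows passing to the infimum over `τ`, including the
case that no valid schedule exists. -/
theorem IsEqEq.setflowtime_le {S : Instance size} {σ : Schedule size p} (h : IsEqEq S σ)
    (hp : 0 < p) {n : ℕ} (hn : ∀ i, size i ≤ n) {β : ℝ} (hβ : 1 < β) :
    setflowtime S σ ≤ ENNReal.ofReal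
      (10 / 9 * (20 / 9 * (Real.log n / Real.log β + 1) + 100 * β)) * OPT p S := by
  set C := 10 / 9 * (20 / 9 * (Real.log n / Real.log β + 1) + 100 * β) with hC
  have hC0 : 0 < C := by
    have := div_nonneg (Real.log_natCast_nonneg n) (Real.log_pos hβ).le
    positivity
  have key : ∀ τ : Schedule size p, IsValid S τ →
      setflowtime S σ ≤ ENNReal.ofReal C * setflowtime S τ := by
    intro τ hτ
    have hfin := setCompletionTime_ne_top hτ
    have e : setflowtime S τ = ENNReal.ofReal (∑ i, (setCompletionTime S τ i).toReal) := by
      rw [← ENNReal.toReal_sum fun i _ => hfin i, ENNReal.ofReal_toReal]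
      · rfl
      · exact ENNReal.sum_ne_top.2 fun i _ => hfin i
    rw [e, ← ENNReal.ofReal_mul hC0.le]
    refine sum_le_of_integral_le fun T hT => ?_
    have h1 := h.integral_numSets_le hp hτ hn hβ hT
    rw [← PC.integral_sum (fun i => (PC.le_ofReal _).not.ind) le_rfl hT]
    simp only [setCompletionTime_le_iff, ← numSets_eq_sum]
    rw [hC]
    linarith
  have hC1 : ENNReal.ofReal C ≠ 0 := by simpa using hC0
  rw [← ENNReal.div_le_iff' hC1 ENNReal.ofReal_ne_top]
  refine le_iInf₂ fun τ hτ => ?_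
  rw [ENNReal.div_le_iff' hC1 ENNReal.ofReal_ne_top]
  exact key τ hτ

end Upper

/-! ### Choice of the parameter and the error term -/

section Asymptotics

open Filter

/-- The competitive ratio established for EQ∘EQ. -/
noncomputable def eqEqRatio (n : ℕ) : ℝ :=
  10 / 9 * (20 / 9 * (Real.log n /
    Real.log (Real.exp 1 + Real.exp (9 / 10 * Real.log (Real.log n))) + 1) +
    100 * (Real.exp 1 + Real.exp (9 / 10 * Real.log (Real.log n))))

theorem one_lt_log_of_three_le {n : ℕ} (hn : 3 ≤ n) : 1 < Real.log n := by
  have h3 : (3 : ℝ) ≤ n := by exact_mod_cast hn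
  rw [Real.lt_log_iff_exp_lt (by linarith)]
  exact (Real.exp_one_lt_d9.trans (by norm_num)).trans_le h3

/-- The main term has constant `10/9 * 20/9 * 10/9 = 2000/729 < 2.75`. The term linear in `β` is of
lower order, as `E` is `(ln n)^(9/10)`. -/
theorem eqEqRatio_le {n : ℕ} (hx : 400000 ≤ Real.log (Real.log n)) (hl : 0 < Real.log n) :
    eqEqRatio n ≤ 3 * (Real.log n / Real.log (Real.log n)) := by
  unfold eqEqRatio
  set x := Real.log (Real.log n) with hxdef
  have hxl : Real.log n = Real.exp x := (Real.exp_log hl).symm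
  rw [hxl]
  set E := Real.exp (9 / 10 * x) with hE
  have hx0 : 0 < x := by linarith
  have hE1 : 1 ≤ E := Real.one_le_exp (by positivity)
  have he : Real.exp 1 ≤ 3 := (Real.exp_one_lt_d9.trans (by norm_num)).le
  have he0 := Real.exp_pos 1
  have hlog : 9 / 10 * x ≤ Real.log (Real.exp 1 + E) := by
    rw [Real.le_log_iff_exp_le (by positivity)]
    linarith
  have hexp : Real.exp x = E * Real.exp (x / 10) := by
    rw [hE, ← Real.exp_add]
    congr 1
    ring
  have h1 : Real.exp x / Real.log (Real.exp 1 + E) ≤ 10 / 9 * (Real.exp x / x) := by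
    calc Real.exp x / Real.log (Real.exp 1 + E) ≤ Real.exp x / (9 / 10 * x) := by gcongr
      _ = 10 / 9 * (Real.exp x / x) := by field_simp
  have h2 : 2000 * E ≤ Real.exp x / x := by
    rw [le_div_iff₀ hx0, hexp]
    have := Real.quadratic_le_exp_of_nonneg (x := x / 10) (by positivity)
    -- The quadratic term `x ^ 2 / 200` of the exponential dominates `2000 * x` exactly from `x =
    -- 400000` on.
    have : 2000 * x ≤ Real.exp (x / 10) := by nlinarith
    nlinarith
  linarith

theorem exists_error_term : ∃ ε : ℕ → ℝ, Tendsto ε atTop (nhds 0) ∧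
    ∀ n : ℕ, 3 ≤ n →
      eqEqRatio n ≤ (2 + √3 + ε n) * Real.log n / Real.log (Real.log n) := by
  -- The excess over `2 + √3`, which is zero for large `n` because `3 ≤ 2 + √3`.
  refine ⟨fun n => max 0 (eqEqRatio n / (Real.log n / Real.log (Real.log n)) - (2 + √3)), ?_, ?_⟩
  · refine tendsto_const_nhds.congr' ?_
    filter_upwards [tendsto_log_log.eventually_ge_atTop 400000, eventually_ge_atTop 3]
      with n hx hn
    have hl := one_lt_log_of_three_le hn
    have hR : 0 < Real.log n / Real.log (Real.log n) := div_pos (by linarith) (by linarith)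
    refine (max_eq_left ?_).symm
    have h1 := (div_le_iff₀ hR).2 (eqEqRatio_le hx (by linarith))
    have h2 : 1 ≤ √3 := Real.one_le_sqrt.2 (by norm_num)
    linarith
  · intro n hn
    have hl := one_lt_log_of_three_le hn
    have hR : 0 < Real.log n / Real.log (Real.log n) := div_pos (by linarith) (Real.log_pos hl)
    rw [mul_div_assoc, ← div_le_iff₀ hR]
    have := le_max_right 0 (eqEqRatio n / (Real.log n / Real.log (Real.log n)) - (2 + √3))
    linarith

end Asymptotics

end SetScheduling

/-! ### Assembly of the three statements -/

theorem mainTheorem1 :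
    -- EQ∘EQ is a well-defined non-clairvoyant algorithm:
    (∀ p : ℝ, 0 < p →
      (∃ A : SetScheduling.NonClairvoyantAlgorithm p,
        ∀ (m : ℕ) (size : Fin m → ℕ) (S : SetScheduling.Instance size),
          SetScheduling.IsEqEq S (A.schedule S)) ∧
      (∀ (m : ℕ) (size : Fin m → ℕ) (S : SetScheduling.Instance size)
        (σ σ' : SetScheduling.Schedule size p),
          SetScheduling.IsEqEq S σ → SetScheduling.IsEqEq S σ' →
          ∀ J t, 0 ≤ t → σ.alloc J t = σ'.alloc J t)) ∧
    -- its competitive ratio, for collections of sets of maximum size `n`: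
    (∃ ε : ℕ → ℝ, Filter.Tendsto ε Filter.atTop (nhds 0) ∧
      ∀ n : ℕ, 3 ≤ n → ∀ p : ℝ, 0 < p →
        ∀ (m : ℕ) (size : Fin m → ℕ), Finset.univ.sup size = n →
          ∀ (S : SetScheduling.Instance size) (σ : SetScheduling.Schedule size p),
            SetScheduling.IsEqEq S σ →
            SetScheduling.setflowtime S σ ≤
              ENNReal.ofReal ((2 + √3 + ε n) * Real.log n / Real.log (Real.log n)) *
                SetScheduling.OPT p S) ∧
    -- the lower bounds, with speed `s n`, attained on single sets of `n` jobs: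
    (∀ s : ℕ → ℝ, (∀ n, 0 < s n) →
      Asymptotics.IsLittleO Filter.atTop s
        (fun n : ℕ => Real.log n / Real.log (Real.log n)) →
      ∀ᶠ n : ℕ in Filter.atTop, ∀ p : ℝ, 0 < p →
        -- deterministic algorithms:
        (∀ A : SetScheduling.NonClairvoyantAlgorithm (s n * p),
          ∀ c : ℝ, c < Real.log n / (2 * Real.log (Real.log n)) →
            ∃ S : SetScheduling.Instance (fun _ : Fin 1 => n),
              ENNReal.ofReal c * SetScheduling.OPT p S <
                SetScheduling.setflowtime S (A.schedule S)) ∧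
        -- randomized algorithms, that is, random deterministic algorithms:
        (∀ (Ω : Type*) [MeasurableSpace Ω] (μ : MeasureTheory.Measure Ω)
          [MeasureTheory.IsProbabilityMeasure μ]
          (A : Ω → SetScheduling.NonClairvoyantAlgorithm (s n * p)),
          (∀ (m : ℕ) (size : Fin m → ℕ) (S : SetScheduling.Instance size),
            Measurable (fun ω => SetScheduling.setflowtime S ((A ω).schedule S))) →
          ∀ c : ℝ, c < Real.log n / (4 * Real.log (Real.log n)) →
            ∃ S : SetScheduling.Instance (fun _ : Fin 1 => n),
              ENNReal.ofReal c * SetScheduling.OPT p S <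
                ∫⁻ ω, SetScheduling.setflowtime S ((A ω).schedule S) ∂μ)) := by
  refine ⟨fun p hp => ⟨SetScheduling.exists_eqEq_algorithm hp.le,
    fun m size S σ σ' h h' => h.unique h'⟩, ?_, ?_⟩
  · obtain ⟨ε, hε, hratio⟩ := SetScheduling.exists_error_term
    refine ⟨ε, hε, fun n hn p hp m size hsize S σ h => ?_⟩
    refine (h.setflowtime_le hp (n := n)
      (β := Real.exp 1 + Real.exp (9 / 10 * Real.log (Real.log n)))
      (fun i => hsize ▸ Finset.le_sup (Finset.mem_univ i)) ?_).trans ?_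
    · have h1 : 1 < Real.exp 1 := Real.one_lt_exp_iff.2 one_pos
      have h2 := Real.exp_pos (9 / 10 * Real.log (Real.log n))
      linarith
    · exact mul_le_mul_left (ENNReal.ofReal_le_ofReal (hratio n hn)) _
  · intro s hs0 hs
    -- Of the little-o hypothesis only the eventual bound with constant 1 is needed.
    filter_upwards [SetScheduling.tendsto_log_log.eventually_ge_atTop 10000,
      hs.bound one_pos, Filter.eventually_ge_atTop 3] with n hx hbound hn p hp
    have hl := SetScheduling.one_lt_log_of_three_le hn
    have hsn : s n ≤ Real.log n / Real.log (Real.log n) := by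
      have hR : 0 < Real.log n / Real.log (Real.log n) :=
        div_pos (by linarith) (Real.log_pos hl)
      rwa [one_mul, Real.norm_of_nonneg (hs0 n).le, Real.norm_of_nonneg hR.le] at hbound
    exact ⟨fun A c hc =>
      SetScheduling.lower_bound_deterministic (by linarith) (hs0 n) hsn hp A hc,
      fun Ω _ μ _ A hA c hc =>
        SetScheduling.lower_bound_randomized hx (hs0 n) hsn hp μ A (fun S => hA _ _ S) hc⟩
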